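/- **Notation.** $\overline D(z,r)$ is the closed disk in $\mathbb C$ with center $z$ and radius $r$. For a real matrix $A=\begin{bmatrix}a&b\\c&d\end{bmatrix}$ the chiral disk is \[\mathrm{CD}(A)=\overline D\left(\tfrac{a+d}2+\tfrac{c-b}2\mathrm i,\ \sqrt{\left(\tfrac{a-d}2\right)^2+\left(\tfrac{b+c}2\right)^2}\right).\] Let $C(x)=\cosh\sqrt x$, $S(x)=\frac{\sinh\sqrt x}{\sqrt x}$ for $x>0$; $C(0)=S(0)=1$; $C(x)=\cos\sqrt{-x}$, $S(x)=\frac{\sin\sqrt{-x}}{\sqrt{-x}}$ for $x<0$; and \[W(p,w)=\begin{bmatrix}\cos w&-\sin w\\\sin w&\cos w\end{bmatrix}\begin{bmatrix}C(p^2-w^2)&(p+w)S(p^2-w^2)\\(p-w)S(p^2-w^2)&C(p^2-w^2)\end{bmatrix}.\] For $s\in\mathbb R$ let $\Phi_s(\theta)=\begin{bmatrix}-\sin(2\theta s)&\cos(2\theta s)\\\cos(2\theta s)&\sin(2\theta s)\end{bmatrix}$, and let \[\mathrm{Lexp}(\Phi_s|_{[0,p]})=\mathrm{Id}+\sum_{n\ge1}\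 \int_{p\ge\theta_1\ge\dots\ge\theta_n\ge0}\Phi_s(\theta_1)\cdots\Phi_s(\theta_n)\,\mathrm d\theta_1\cdots\mathrm d\theta_n\] be its left time-ordered exponential (the hyperbolic development). **Theorem.** Let $0<p<\pi$. Put $\gamma_p(t)=\mathrm e^{p\cos t+\mathrm ip\sin t}$ and \[\Omega_p(t)=\mathrm e^{\mathrm ip\sin t}\left(\cosh(p\cos t)-\mathrm i\,\frac{\sinh(p\cos t)\sin t}{\cos t}\right),\qquad \omega_p(t)=\frac{\sinh(p\cos t)}{\cos t}\qquad\text{if }\cos t\ne0,\] \[\Omega_p(\pm\pi/2)=(\cos p+p\sin p)\pm\mathrm i(\sin p-p\cos p),\qquad\omega_p(\pm\pi/2)=p.\] (a) Let $t\in[-\pi/2,\pi/2]$. Then $\omega_p(t)>0$, and the circle $\partial\overline D(\Omega_p(t),\omega_p(t))$ is tangent to $\partial\exp\overline D(0,p)$ at $\gamma_p(t)$ and at $\gamma_p(\pi-t)=\mathrm e^{-p\cos t+\mathrm ip\sin t}$. These two points are inverses of each other relative to the unit circle. They are equal if and only if $t=\pm\pi/2$, and in that case $\overline D(\Omega_p(t),\omega_p(t))$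 is the osculating disk of $\partial\exp\overline D(0,p)$ at $\gamma_p(t)$. The circle $\partial\overline D(\Omega_p(t),\omega_p(t))$ is orthogonal to the unit circle. The disks belonging to different $t\in[-\pi/2,\pi/2]$ are distinct. If $\Omega_p$ and $\omega_p$ are extended to $t\in[-\pi,\pi]$ by the same formulas, then $\Omega_p(t)=\Omega_p(s)$ and $\omega_p(t)=\omega_p(s)$ whenever $s,t\in[-\pi,\pi]$ and $s\equiv\pi-t\pmod{2\pi}$. (b) For $t\in[-\pi/2,\pi/2]$ the series defining $\mathrm{Lexp}(\Phi_{\sin t}|_{[0,p]})$ is summable, and \[\mathrm{CD}(\mathrm{Lexp}(\Phi_{\sin t}|_{[0,p]}))=\mathrm{CD}(W(p,p\sin t))=\overline D(\Omega_p(t),\omega_p(t)).\] (c) The disks $\overline D(\Omega_p(t),\omega_p(t))$, $t\in[-\pi/2,\pi/2]$, are exactly the maximal disks in $\exp\overline D(0,p)$, i.e. the maximal elements, with respect to inclusion, of the set of all closed disks (points allowed) contained in $\exp\overline D(0,p)$. For each $t\in[-\pi/2,\pi/2]$, \[\overline D(\Omega_p(t),\omega_p(t))\cap\partial\exp\overline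 D(0,p)=\{\gamma_p(t),\gamma_p(\pi-t)\}.\] -/

import Mathlib

open scoped Topology Matrix

noncomputable section

namespace MagnusDisks

/-! ### The curve, the region, and the family of disks -/

/-- The set `exp D̄(0,p)`. -/
def expDisk (p : ℝ) : Set ℂ := Complex.exp '' Metric.closedBall (0 : ℂ) p

/-- `γ_p(t) = e^{p cos t + i p sin t}`. -/
def gam (p t : ℝ) : ℂ :=
  Complex.exp (((p * Real.cos t : ℝ) : ℂ) + Complex.I * ((p * Real.sin t : ℝ) : ℂ))

/-- The centers `Ω_p(t)`. For `t ∈ [-π, π]` the case `cos t = 0` means `t = ± π/2`, and then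
`sin t = ± 1` is the sign in `Ω_p(± π/2) = (cos p + p sin p) ± i (sin p - p cos p)`. -/
def Omega (p t : ℝ) : ℂ :=
  if Real.cos t = 0 then
    ((Real.cos p + p * Real.sin p : ℝ) : ℂ)
      + ((Real.sin t * (Real.sin p - p * Real.cos p) : ℝ) : ℂ) * Complex.I
  else
    Complex.exp (Complex.I * ((p * Real.sin t : ℝ) : ℂ)) *
      (((Real.cosh (p * Real.cos t) : ℝ) : ℂ)
        - Complex.I * ((Real.sinh (p * Real.cos t) * Real.sin t / Real.cos t : ℝ) : ℂ))

/-- The radii `ω_p(t)`. -/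
def omega (p t : ℝ) : ℝ :=
  if Real.cos t = 0 then p else Real.sinh (p * Real.cos t) / Real.cos t

/-- The closed disk `D̄(Ω_p(t), ω_p(t))`. -/
def disk (p t : ℝ) : Set ℂ := Metric.closedBall (Omega p t) (omega p t)

/-- `D` is a closed disk, possibly reduced to a point, which is contained in `K`. -/
def IsDiskIn (K D : Set ℂ) : Prop :=
  (∃ (c : ℂ) (r : ℝ), 0 ≤ r ∧ D = Metric.closedBall c r) ∧ D ⊆ K

/-- `D` is a maximal disk in `K`: maximal, for inclusion, among the closed disks in `K`. -/
def IsMaximalDiskIn (K D : Set ℂ) : Prop := Maximal (IsDiskIn K) D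

/-! ### Tangency, osculation, orthogonality -/

/-- `c`, near the parameter `0`, is a regular `C²` parametrization of the set `S` near its point
`z`: small neighbourhoods of `0` are mapped exactly onto small neighbourhoods of `z` in `S`. -/
structure IsLocalParam (c : ℝ → ℂ) (S : Set ℂ) (z : ℂ) : Prop where
  map_zero : c 0 = z
  contDiffAt : ContDiffAt ℝ 2 c 0
  deriv_ne_zero : deriv c 0 ≠ 0
  map_nhds : Filter.map c (𝓝 0) = 𝓝[S] z

/-- The sets `S` and `T` are regular plane curves near their common point `z`, where they have the
same tangent line. -/
def IsTangentAt (S T : Set ℂ) (z : ℂ) : Prop :=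
  ∃ c d : ℝ → ℂ, IsLocalParam c S z ∧ IsLocalParam d T z ∧
    ∃ a : ℝ, a ≠ 0 ∧ deriv c 0 = a • deriv d 0

/-- The oriented curvature `det(c', c'') / |c'|³` of a plane curve. -/
def signedCurvature (c : ℝ → ℂ) (s : ℝ) : ℝ :=
  ((starRingEnd ℂ) (deriv c s) * deriv (deriv c) s).im / ‖deriv c s‖ ^ 3

/-- The disk `D̄(w,r)` is the osculating disk of the plane curve `S` at `z`: its radius is the
radius of curvature of `S` at `z`, and its center is the center of curvature `z + κ⁻¹ N`, where
`N = i c' / |c'|`. -/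
def IsOsculatingDisk (w : ℂ) (r : ℝ) (S : Set ℂ) (z : ℂ) : Prop :=
  ∃ c : ℝ → ℂ, IsLocalParam c S z ∧ signedCurvature c 0 ≠ 0 ∧
    w = z + (signedCurvature c 0)⁻¹ • (Complex.I * (deriv c 0 / ((‖deriv c 0‖ : ℝ) : ℂ))) ∧
    r = |signedCurvature c 0|⁻¹

/-- The circles `∂D̄(w₁,r₁)` and `∂D̄(w₂,r₂)` are orthogonal: they intersect, and at each
intersection point their radii are perpendicular. -/
def CirclesOrthogonal (w₁ : ℂ) (r₁ : ℝ) (w₂ : ℂ) (r₂ : ℝ) : Prop :=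
  (Metric.sphere w₁ r₁ ∩ Metric.sphere w₂ r₂).Nonempty ∧
    ∀ z ∈ Metric.sphere w₁ r₁ ∩ Metric.sphere w₂ r₂, inner ℝ (z - w₁) (z - w₂) = 0

/-! ### Chiral disks and hyperbolic developments -/

/-- The chiral disk of a real matrix with rows `(a, b)` and `(c, d)`: the closed disk with center
`(a+d)/2 + i (c-b)/2` and radius `√(((a-d)/2)² + ((b+c)/2)²)`. -/
def chiralDisk (A : Matrix (Fin 2) (Fin 2) ℝ) : Set ℂ :=
  Metric.closedBall
    ((((A 0 0 + A 1 1) / 2 : ℝ) : ℂ) + (((A 1 0 - A 0 1) / 2 : ℝ) : ℂ) * Complex.I)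
    (Real.sqrt (((A 0 0 - A 1 1) / 2) ^ 2 + ((A 0 1 + A 1 0) / 2) ^ 2))

/-- The entire function `cosh √x` on the real line. -/
def CC (x : ℝ) : ℝ :=
  if x < 0 then Real.cos (Real.sqrt (-x)) else if x = 0 then 1 else Real.cosh (Real.sqrt x)

/-- The entire function `sinh √x / √x` on the real line. -/
def SS (x : ℝ) : ℝ :=
  if x < 0 then Real.sin (Real.sqrt (-x)) / Real.sqrt (-x)
  else if x = 0 then 1 else Real.sinh (Real.sqrt x) / Real.sqrt x

/-- The matrix `W(p,w)`. -/
def W (p w : ℝ) : Matrix (Fin 2) (Fin 2) ℝ :=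
  !![Real.cos w, -Real.sin w; Real.sin w, Real.cos w] *
    !![CC (p ^ 2 - w ^ 2), (p + w) * SS (p ^ 2 - w ^ 2);
       (p - w) * SS (p ^ 2 - w ^ 2), CC (p ^ 2 - w ^ 2)]

/-- The density, at time `θ`, of the hyperbolic development with speed `s`. -/
def Phi (s θ : ℝ) : Matrix (Fin 2) (Fin 2) ℝ :=
  !![-Real.sin (2 * (θ * s)), Real.cos (2 * (θ * s));
     Real.cos (2 * (θ * s)), Real.sin (2 * (θ * s))]

/-- The `n`-th term of the left time-ordered exponential of the matrix-valued measure
`φ(θ) dθ` on `[a,x]`: the iterated integral of `φ(θ₁) φ(θ₂) ⋯ φ(θₙ)` over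
`x ≥ θ₁ ≥ θ₂ ≥ ⋯ ≥ θₙ ≥ a` (integration is entrywise). -/
def lexpTerm (φ : ℝ → Matrix (Fin 2) (Fin 2) ℝ) (a : ℝ) : ℕ → ℝ → Matrix (Fin 2) (Fin 2) ℝ
  | 0, _ => 1
  | n + 1, x => Matrix.of fun i j => ∫ θ in a..x, (φ θ * lexpTerm φ a n θ) i j

/-- The left time-ordered exponential of `φ(θ) dθ` on `[a,b]`. -/
def lexp (φ : ℝ → Matrix (Fin 2) (Fin 2) ℝ) (a b : ℝ) : Matrix (Fin 2) (Fin 2) ℝ :=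
  ∑' n : ℕ, lexpTerm φ a n b

end MagnusDisks

end

open MagnusDisks

namespace MagnusDisks

/-! ### The functions `CC` and `SS` -/

/-! Everything is read in logarithmic coordinates. Put `κ = p cos t`, `σ = p sin t`, `A = C(κ²)`, `B
= S(κ²)`. Then `Ω = e^{iσ}(A - iσB)` and `ω = pB`, also when `cos t = 0`. From `cosh² - sinh² = 1`
follows `|Ω|² = 1 + ω²`, which is orthogonality to the unit circle. It also makes `|z - Ω|² - ω²`,
at `z = e^{u+i(σ+v)}`, a positive multiple of `cosh u - (A cos v - σB sin v)`.

Since `C` increases on `[-π², ∞)`, the condition `u² + y² ≤ p²` reads `cosh u ≤ C(p² - y²)` for `|y|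
≤ π`. Containment of the disk thus reduces to `A cos v - σB sin v < C(p² - (σ+v)²)` for `v ≠ 0`
(`slice_lt_of_pos`). The two sides agree to first order at `v = 0`, and their difference `M`
satisfies `M'' + M = 2p² S' > 0`, so variation of constants gives `M > 0` up to `|v| = π`. Equality
at `v = 0` only yields exactly the contact points `γ(t)` and `γ(π-t)`.

For maximality, a disk in the region that touches the boundary has its center on the inner normal
there (`center_eq_of_touches`), and disks tangent at a common point on the same side are nested. One
larger than `D̄(Ω, ω)` would have the other contact point in its interior; when the contact points
coincide, it would violate the curvature bound. Every disk in the region can be enlarged until it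
touches, so it lies in some `D̄(Ω, ω)` (`exists_disk_superset`). None of these contains another,
because the contact points determine `sin t`.

For the hyperbolic development, `W(x, xs)` solves `A' = Φ_s A`, `A(0) = 1`. Iterating the integral
equation gives the partial sums of the series with a remainder of factorial decay
(`hasSum_lexpTerm`). -/

lemma CC_sq (r : ℝ) : CC (r ^ 2) = Real.cosh r := by
  unfold CC
  rw [if_neg (not_lt.2 (sq_nonneg r)), Real.sqrt_sq_eq_abs, Real.cosh_abs]
  split_ifs with h
  · rw [pow_eq_zero_iff two_ne_zero] at h
    simp [h]
  · rfl

lemma CC_neg_sq (r : ℝ) : CC (-r ^ 2) = Real.cos r := by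
  unfold CC
  rw [neg_neg, Real.sqrt_sq_eq_abs, Real.cos_abs]
  rcases eq_or_ne r 0 with rfl | h
  · simp
  · rw [if_pos (neg_lt_zero.2 (by positivity))]

lemma SS_zero : SS 0 = 1 := by simp [SS]

lemma SS_sq {r : ℝ} (hr : r ≠ 0) : SS (r ^ 2) = Real.sinh r / r := by
  have h2 : 0 < r ^ 2 := by positivity
  unfold SS
  rw [if_neg h2.not_gt, if_neg h2.ne', Real.sqrt_sq_eq_abs]
  rcases abs_cases r with h | h <;> simp [h.1]

lemma SS_neg_sq {r : ℝ} (hr : r ≠ 0) : SS (-r ^ 2) = Real.sin r / r := by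
  have h2 : -r ^ 2 < 0 := neg_lt_zero.2 (by positivity)
  unfold SS
  rw [if_pos h2, neg_neg, Real.sqrt_sq_eq_abs]
  rcases abs_cases r with h | h <;> simp [h.1]

lemma mul_SS_sq (r : ℝ) : r * SS (r ^ 2) = Real.sinh r := by
  rcases eq_or_ne r 0 with rfl | h
  · simp
  · rw [SS_sq h, mul_div_cancel₀ _ h]

/-- A function on the real line is continuous at `0` as soon as it is so along `± r²`. -/
lemma continuousAt_zero_of_sq {f : ℝ → ℝ}
    (h1 : Filter.Tendsto (fun r => f (r ^ 2)) (𝓝[≠] 0) (𝓝 (f 0)))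
    (h2 : Filter.Tendsto (fun r => f (-r ^ 2)) (𝓝[≠] 0) (𝓝 (f 0))) : ContinuousAt f 0 := by
  rw [continuousAt_iff_punctured_nhds, ← Set.Iio_union_Ioi, nhdsWithin_union]
  have hs : Filter.Tendsto Real.sqrt (𝓝[>] 0) (𝓝[≠] 0) := by
    refine tendsto_nhdsWithin_iff.2 ⟨?_, ?_⟩
    · have := Real.continuous_sqrt.tendsto 0
      rw [Real.sqrt_zero] at this
      exact this.mono_left nhdsWithin_le_nhds
    · filter_upwards [self_mem_nhdsWithin] with x hx
      exact (Real.sqrt_pos.2 hx).ne'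
  have hn : Filter.Tendsto (fun x : ℝ => -x) (𝓝[<] 0) (𝓝[>] 0) := by
    refine tendsto_nhdsWithin_iff.2 ⟨?_, ?_⟩
    · have := (continuous_neg (G := ℝ)).tendsto 0
      rw [neg_zero] at this
      exact this.mono_left nhdsWithin_le_nhds
    · filter_upwards [self_mem_nhdsWithin] with x hx
      exact neg_pos.2 (Set.mem_Iio.1 hx)
  refine Filter.Tendsto.sup ?_ ?_
  · refine (h2.comp (hs.comp hn)).congr' ?_
    filter_upwards [self_mem_nhdsWithin] with x hx
    simp only [Function.comp_apply]
    rw [Real.sq_sqrt (neg_pos.2 (Set.mem_Iio.1 hx)).le, neg_neg]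
  · refine (h1.comp hs).congr' ?_
    filter_upwards [self_mem_nhdsWithin] with x hx
    simp only [Function.comp_apply]
    rw [Real.sq_sqrt (le_of_lt hx)]

lemma tendsto_sinh_div : Filter.Tendsto (fun r => Real.sinh r / r) (𝓝[≠] 0) (𝓝 1) := by
  have := hasDerivAt_iff_tendsto_slope.1 (Real.hasDerivAt_sinh 0)
  rw [Real.cosh_zero] at this
  refine this.congr fun r => ?_
  simp [slope_def_field]

lemma tendsto_sin_div : Filter.Tendsto (fun r => Real.sin r / r) (𝓝[≠] 0) (𝓝 1) := by
  have := hasDerivAt_iff_tendsto_slope.1 (Real.hasDerivAt_sin 0)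
  rw [Real.cos_zero] at this
  refine this.congr fun r => ?_
  simp [slope_def_field]

lemma continuousAt_CC_zero : ContinuousAt CC 0 := by
  have h0 : CC 0 = 1 := by simp [CC]
  refine continuousAt_zero_of_sq ?_ ?_
  · simp only [CC_sq, h0]
    have := Real.continuous_cosh.tendsto 0
    rw [Real.cosh_zero] at this
    exact this.mono_left nhdsWithin_le_nhds
  · simp only [CC_neg_sq, h0]
    have := Real.continuous_cos.tendsto 0
    rw [Real.cos_zero] at this
    exact this.mono_left nhdsWithin_le_nhds

lemma continuousAt_SS_zero : ContinuousAt SS 0 := by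
  refine continuousAt_zero_of_sq ?_ ?_ <;> rw [SS_zero]
  · refine tendsto_sinh_div.congr' ?_
    filter_upwards [self_mem_nhdsWithin] with r hr using (SS_sq hr).symm
  · refine tendsto_sin_div.congr' ?_
    filter_upwards [self_mem_nhdsWithin] with r hr using (SS_neg_sq hr).symm

/-- The derivative of `SS`. -/
noncomputable def SSderiv (x : ℝ) : ℝ := if x = 0 then 1 / 6 else (CC x - SS x) / (2 * x)

lemma hasDerivAt_mul_cosh_sub_sinh (r : ℝ) :
    HasDerivAt (fun r => r * Real.cosh r - Real.sinh r) (r * Real.sinh r) r := by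
  refine (((hasDerivAt_id r).mul (Real.hasDerivAt_cosh r)).sub
    (Real.hasDerivAt_sinh r)).congr_deriv ?_
  simp

lemma hasDerivAt_sin_sub_mul_cos (r : ℝ) :
    HasDerivAt (fun r => Real.sin r - r * Real.cos r) (r * Real.sin r) r := by
  refine ((Real.hasDerivAt_sin r).sub
    ((hasDerivAt_id r).mul (Real.hasDerivAt_cos r))).congr_deriv ?_
  simp

/-- A function with derivative `r g(r)` which vanishes at `0` is `g'(0) r³/3` to first order. -/
lemma tendsto_div_cube {f g : ℝ → ℝ} (hf : ∀ r, HasDerivAt f (r * g r) r) (hf0 : f 0 = 0)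
    (hg : Filter.Tendsto (fun r => g r / r) (𝓝[≠] 0) (𝓝 1)) :
    Filter.Tendsto (fun r => f r / (2 * r ^ 3)) (𝓝[≠] 0) (𝓝 (1 / 6)) := by
  refine HasDerivAt.lhopital_zero_nhdsNE (f' := fun r => r * g r) (g' := fun r => 6 * r ^ 2)
    (.of_forall hf) (.of_forall fun r => ?_) ?_ ?_ ?_ ?_
  · refine ((hasDerivAt_pow 3 r).const_mul 2).congr_deriv ?_
    norm_num
    ring
  · filter_upwards [self_mem_nhdsWithin] with r hr
    have : r ≠ 0 := hr
    positivity
  · have := (hf 0).continuousAt.tendsto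
    rw [hf0] at this
    exact this.mono_left nhdsWithin_le_nhds
  · have : Filter.Tendsto (fun r : ℝ => 2 * r ^ 3) (𝓝 0) (𝓝 (2 * 0 ^ 3)) :=
      Continuous.tendsto (by fun_prop) 0
    norm_num at this
    exact this.mono_left nhdsWithin_le_nhds
  · have := hg.div_const 6
    refine this.congr' ?_
    filter_upwards [self_mem_nhdsWithin] with r hr
    have : r ≠ 0 := hr
    field_simp

lemma SSderiv_sq {r : ℝ} (hr : r ≠ 0) :
    SSderiv (r ^ 2) = (r * Real.cosh r - Real.sinh r) / (2 * r ^ 3) := by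
  have h2 : r ^ 2 ≠ 0 := by positivity
  rw [SSderiv, if_neg h2, CC_sq, SS_sq hr]
  field_simp

lemma SSderiv_neg_sq {r : ℝ} (hr : r ≠ 0) :
    SSderiv (-r ^ 2) = (Real.sin r - r * Real.cos r) / (2 * r ^ 3) := by
  have h2 : -r ^ 2 ≠ 0 := neg_ne_zero.2 (by positivity)
  rw [SSderiv, if_neg h2, CC_neg_sq, SS_neg_sq hr]
  field_simp
  ring

lemma continuousAt_SSderiv_zero : ContinuousAt SSderiv 0 := by
  have h0 : SSderiv 0 = 1 / 6 := by simp [SSderiv]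
  refine continuousAt_zero_of_sq ?_ ?_ <;> rw [h0]
  · refine (tendsto_div_cube hasDerivAt_mul_cosh_sub_sinh (by simp) tendsto_sinh_div).congr' ?_
    filter_upwards [self_mem_nhdsWithin] with r hr using (SSderiv_sq hr).symm
  · refine (tendsto_div_cube hasDerivAt_sin_sub_mul_cos (by simp) tendsto_sin_div).congr' ?_
    filter_upwards [self_mem_nhdsWithin] with r hr using (SSderiv_neg_sq hr).symm

lemma hasDerivAt_of_sq {f : ℝ → ℝ} {f' r : ℝ} (hr : 0 < r)
    (h : HasDerivAt (fun r => f (r ^ 2)) (2 * r * f') r) : HasDerivAt f f' (r ^ 2) := by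
  have h1 := Real.hasDerivAt_sqrt (show r ^ 2 ≠ 0 by positivity)
  rw [Real.sqrt_sq hr.le] at h1
  have h2 := HasDerivAt.comp (r ^ 2) (h₂ := fun r => f (r ^ 2)) (by rwa [Real.sqrt_sq hr.le]) h1
  refine (h2.congr_of_eventuallyEq ?_).congr_deriv ?_
  rotate_left
  · field_simp
  · filter_upwards [eventually_gt_nhds (show 0 < r ^ 2 by positivity)] with x hx
    simp only [Function.comp_apply, Real.sq_sqrt hx.le]

lemma hasDerivAt_of_neg_sq {f : ℝ → ℝ} {f' r : ℝ} (hr : 0 < r)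
    (h : HasDerivAt (fun r => f (-r ^ 2)) (-2 * r * f') r) : HasDerivAt f f' (-r ^ 2) := by
  have h1 : HasDerivAt (fun x => f (-x)) (-f') (r ^ 2) :=
    hasDerivAt_of_sq (f := fun x => f (-x)) hr (h.congr_deriv (by ring))
  have h2 := HasDerivAt.comp (-r ^ 2) (h₂ := fun x => f (-x)) (by rwa [neg_neg])
    (hasDerivAt_neg (-r ^ 2))
  refine (h2.congr_of_eventuallyEq (.of_forall fun x => ?_)).congr_deriv ?_
  · simp
  · ring

lemma exists_sq_or_neg_sq {x : ℝ} (hx : x ≠ 0) : ∃ r, 0 < r ∧ (x = r ^ 2 ∨ x = -r ^ 2) := by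
  rcases hx.lt_or_gt with h | h
  · exact ⟨√(-x), Real.sqrt_pos.2 (by linarith), .inr (by rw [Real.sq_sqrt (by linarith)]; ring)⟩
  · exact ⟨√x, Real.sqrt_pos.2 h, .inl (by rw [Real.sq_sqrt h.le])⟩

/-- Away from `0` this is the chain rule along `± r²`. At `0` it follows from the continuity of the
function and of the candidate derivative. -/
lemma hasDerivAt_CC (x : ℝ) : HasDerivAt CC (SS x / 2) x := by
  refine hasDerivAt_of_hasDerivAt_of_ne' (x := 0) (g := fun x => SS x / 2) (fun y hy => ?_)
    continuousAt_CC_zero (continuousAt_SS_zero.div_const 2) x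
  obtain ⟨r, hr, rfl | rfl⟩ := exists_sq_or_neg_sq hy
  · refine hasDerivAt_of_sq hr ?_
    simp only [CC_sq, SS_sq hr.ne']
    refine (Real.hasDerivAt_cosh r).congr_deriv ?_
    field_simp
  · refine hasDerivAt_of_neg_sq hr ?_
    simp only [CC_neg_sq, SS_neg_sq hr.ne']
    refine (Real.hasDerivAt_cos r).congr_deriv ?_
    field_simp

lemma hasDerivAt_SS (x : ℝ) : HasDerivAt SS (SSderiv x) x := by
  refine hasDerivAt_of_hasDerivAt_of_ne' (x := 0) (g := SSderiv) (fun y hy => ?_)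
    continuousAt_SS_zero continuousAt_SSderiv_zero x
  obtain ⟨r, hr, rfl | rfl⟩ := exists_sq_or_neg_sq hy
  · refine hasDerivAt_of_sq hr ?_
    rw [SSderiv_sq hr.ne']
    have h := (Real.hasDerivAt_sinh r).div (hasDerivAt_id r) hr.ne'
    refine (h.congr_of_eventuallyEq ?_).congr_deriv ?_
    rotate_left
    · simp only [id]
      field_simp
    · filter_upwards [eventually_gt_nhds hr] with s hs
      simp [SS_sq hs.ne']
  · refine hasDerivAt_of_neg_sq hr ?_
    rw [SSderiv_neg_sq hr.ne']
    have h := (Real.hasDerivAt_sin r).div (hasDerivAt_id r) hr.ne'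
    refine (h.congr_of_eventuallyEq ?_).congr_deriv ?_
    rotate_left
    · simp only [id]
      field_simp
      ring
    · filter_upwards [eventually_gt_nhds hr] with s hs
      simp [SS_neg_sq hs.ne']

/-- The differential relation that closes the system of `CC` and `SS`. It makes the second
derivative in the main inequality collapse, and it differentiates `x * SS` in `W`. -/
lemma CC_sub_SS (x : ℝ) : CC x - SS x = 2 * x * SSderiv x := by
  unfold SSderiv
  split_ifs with h
  · simp [h, CC, SS]
  · field_simp

lemma SS_pos {x : ℝ} (hx : -Real.pi ^ 2 < x) : 0 < SS x := by
  rcases eq_or_ne x 0 with rfl | h0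
  · simp [SS_zero]
  obtain ⟨r, hr, rfl | rfl⟩ := exists_sq_or_neg_sq h0
  · rw [SS_sq hr.ne']
    exact div_pos (Real.sinh_pos_iff.2 hr) hr
  · rw [SS_neg_sq hr.ne']
    exact div_pos (Real.sin_pos_of_pos_of_lt_pi hr
      (lt_of_pow_lt_pow_left₀ 2 Real.pi_pos.le (by linarith))) hr

lemma pos_of_hasDerivAt_pos {f f' : ℝ → ℝ} {r : ℝ} (hr : 0 < r) (h : ∀ x, HasDerivAt f (f' x) x)
    (h' : ∀ x ∈ Set.Ioo 0 r, 0 < f' x) (h0 : f 0 = 0) : 0 < f r := by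
  rw [← h0]
  refine strictMonoOn_of_deriv_pos (convex_Icc 0 r)
    (fun x _ => (h x).continuousAt.continuousWithinAt) (fun x hx => ?_)
    (Set.left_mem_Icc.2 hr.le) (Set.right_mem_Icc.2 hr.le) hr
  rw [interior_Icc] at hx
  rw [(h x).deriv]
  exact h' x hx

/-- Both numerators vanish at `0` and have derivative `r sinh r` or `r sin r`; the latter is
positive up to `r = π`, whence the bound `-π²`. -/
lemma SSderiv_pos {x : ℝ} (hx : -Real.pi ^ 2 < x) : 0 < SSderiv x := by
  rcases eq_or_ne x 0 with rfl | h0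
  · simp [SSderiv]
  obtain ⟨r, hr, rfl | rfl⟩ := exists_sq_or_neg_sq h0
  · rw [SSderiv_sq hr.ne']
    refine div_pos (pos_of_hasDerivAt_pos (f := fun r => r * Real.cosh r - Real.sinh r) hr
      hasDerivAt_mul_cosh_sub_sinh (fun y hy => ?_) (by simp)) (by positivity)
    exact mul_pos hy.1 (Real.sinh_pos_iff.2 hy.1)
  · rw [SSderiv_neg_sq hr.ne']
    have hrpi : r < Real.pi := lt_of_pow_lt_pow_left₀ 2 Real.pi_pos.le (by linarith)
    refine div_pos (pos_of_hasDerivAt_pos (f := fun r => Real.sin r - r * Real.cos r) hr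
      hasDerivAt_sin_sub_mul_cos (fun y hy => ?_) (by simp)) (by positivity)
    exact mul_pos hy.1 (Real.sin_pos_of_pos_of_lt_pi hy.1 (hy.2.trans hrpi))

lemma CC_strictMonoOn : StrictMonoOn CC (Set.Ici (-Real.pi ^ 2)) := by
  refine strictMonoOn_of_deriv_pos (convex_Ici _)
    (fun x _ => (hasDerivAt_CC x).continuousAt.continuousWithinAt) (fun x hx => ?_)
  rw [interior_Ici] at hx
  rw [(hasDerivAt_CC x).deriv]
  exact half_pos (SS_pos hx)

/-! ### The main inequality -/

/-- In logarithmic coordinates `u + i (σ + v)`, the disk `D̄(Ω, ω)` is given by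
`cosh u ≤ slice κ σ v`. -/
noncomputable def slice (κ σ v : ℝ) : ℝ := CC (κ ^ 2) * Real.cos v - σ * SS (κ ^ 2) * Real.sin v

lemma slice_neg (κ σ v : ℝ) : slice κ (-σ) (-v) = slice κ σ v := by
  simp [slice]

/-- The trigonometric side solves `f'' + f = 0`, while `C(p² - y²)` satisfies `f'' + f = 2p² S'(p² -
y²)`, and the Cauchy data agree at `v = 0`. The difference `M`, with derivative `N`, is therefore
the integral of `2p² S' sin(v - τ)` over `0 ≤ τ ≤ v`. -/
lemma slice_lt_of_pos {p κ σ v : ℝ} (hp : 0 < p) (hppi : p < Real.pi) (h : κ ^ 2 + σ ^ 2 = p ^ 2)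
    (hv : 0 < v) (hvpi : v ≤ Real.pi) (hy : σ + v ≤ Real.pi) :
    slice κ σ v < CC (p ^ 2 - (σ + v) ^ 2) := by
  have hσ : -Real.pi < σ := by
    have := abs_le_of_sq_le_sq' (show σ ^ 2 ≤ p ^ 2 by nlinarith) hp.le
    linarith [this.1]
  set A := CC (κ ^ 2)
  set B := SS (κ ^ 2)
  have hx : ∀ τ, HasDerivAt (fun τ => p ^ 2 - (σ + τ) ^ 2) (-2 * (σ + τ)) τ := fun τ => by
    have := (((hasDerivAt_id τ).const_add σ).pow 2).const_sub (p ^ 2)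
    refine this.congr_deriv ?_
    simp
  set M : ℝ → ℝ := fun τ =>
    CC (p ^ 2 - (σ + τ) ^ 2) - (A * Real.cos τ - σ * B * Real.sin τ) with hM
  set N : ℝ → ℝ := fun τ =>
    -(σ + τ) * SS (p ^ 2 - (σ + τ) ^ 2) - (-A * Real.sin τ - σ * B * Real.cos τ) with hN
  have hMd : ∀ τ, HasDerivAt M (N τ) τ := fun τ => by
    have h1 := (hasDerivAt_CC _).comp τ (hx τ)
    have h2 := ((Real.hasDerivAt_cos τ).const_mul A).sub
      ((Real.hasDerivAt_sin τ).const_mul (σ * B))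
    refine (h1.sub h2).congr_deriv ?_
    simp only [hN]
    ring
  have hNd : ∀ τ, HasDerivAt N
      (2 * p ^ 2 * SSderiv (p ^ 2 - (σ + τ) ^ 2) - M τ) τ := fun τ => by
    have h1 := (hasDerivAt_SS _).comp τ (hx τ)
    have h2 := ((Real.hasDerivAt_sin τ).const_mul (-A)).sub
      ((Real.hasDerivAt_cos τ).const_mul (σ * B))
    refine (((((hasDerivAt_id τ).const_add σ).neg).mul h1).sub h2).congr_deriv ?_
    simp only [hM, Function.comp_apply, Pi.neg_apply, id]
    linear_combination CC_sub_SS (p ^ 2 - (σ + τ) ^ 2)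
  -- Variation of constants without an integral: this function vanishes at `τ = 0`, equals `M v` at
  -- `τ = v`, and has derivative `(M'' + M) sin(v - τ)`.
  have hL : ∀ τ, HasDerivAt (fun τ => N τ * Real.sin (v - τ) + M τ * Real.cos (v - τ))
      (2 * p ^ 2 * SSderiv (p ^ 2 - (σ + τ) ^ 2) * Real.sin (v - τ)) τ := fun τ => by
    have h1 := ((hNd τ).mul (((hasDerivAt_id τ).const_sub v).sin)).add
      ((hMd τ).mul (((hasDerivAt_id τ).const_sub v).cos))
    refine h1.congr_deriv ?_
    simp only [id]
    ring
  have e : p ^ 2 - (σ + 0) ^ 2 = κ ^ 2 := by linarith [h]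
  have := pos_of_hasDerivAt_pos hv hL (fun τ hτ => ?_) ?_
  · simp only [sub_self, Real.sin_zero, Real.cos_zero, mul_zero, mul_one, zero_add, hM] at this
    simp only [slice]
    linarith
  · refine mul_pos (mul_pos (by positivity) (SSderiv_pos ?_))
      (Real.sin_pos_of_pos_of_lt_pi (by linarith [hτ.2]) (by linarith [hτ.1]))
    have h1 : (σ + τ) ^ 2 < Real.pi ^ 2 := by
      refine sq_lt_sq' ?_ ?_ <;> linarith [hτ.1, hτ.2]
    nlinarith
  · simp only [hM, hN, e]
    simp [A, B]

/-- Beyond argument `π` the disk has no points at all, as `cosh u ≥ 1`. For `v ≤ π/2` the slice has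
decreased since `v = π - σ`, where it is below `C(p² - π²) < 1`; for `v ≥ π/2` it is nonpositive. -/
lemma slice_lt_one_of_pos {p κ σ v : ℝ} (hp : 0 < p) (hppi : p < Real.pi)
    (h : κ ^ 2 + σ ^ 2 = p ^ 2) (hv : 0 ≤ v) (hvpi : v ≤ Real.pi) (hy : Real.pi ≤ σ + v) :
    slice κ σ v < 1 := by
  have hσ : σ ≤ p := (abs_le_of_sq_le_sq' (show σ ^ 2 ≤ p ^ 2 by nlinarith) hp.le).2
  have hA : 0 < CC (κ ^ 2) := by rw [CC_sq]; exact Real.cosh_pos κ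
  have hB : 0 < SS (κ ^ 2) := SS_pos (by nlinarith [Real.pi_pos])
  have hσ0 : 0 ≤ σ := by linarith
  rcases le_total v (Real.pi / 2) with h2 | h2
  · have h1 := slice_lt_of_pos (v := Real.pi - σ) hp hppi h (by linarith) (by linarith)
      (by linarith)
    have h3 : CC (p ^ 2 - (σ + (Real.pi - σ)) ^ 2) < CC (0 ^ 2) := by
      apply CC_strictMonoOn
      · simp only [Set.mem_Ici]; nlinarith
      · simp only [Set.mem_Ici]; nlinarith
      · nlinarith
    rw [CC_sq, Real.cosh_zero] at h3
    refine lt_of_le_of_lt ?_ (h1.trans h3)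
    unfold slice
    have hc : Real.cos v ≤ Real.cos (Real.pi - σ) :=
      Real.cos_le_cos_of_nonneg_of_le_pi (by linarith) (by linarith) (by linarith)
    have hs : Real.sin (Real.pi - σ) ≤ Real.sin v :=
      Real.sin_le_sin_of_le_of_le_pi_div_two (by linarith) (by linarith) (by linarith)
    gcongr
  · have hc := Real.cos_nonpos_of_pi_div_two_le_of_le h2 (by linarith)
    have hs := Real.sin_nonneg_of_nonneg_of_le_pi hv hvpi
    unfold slice
    have := mul_nonneg (mul_nonneg hσ0 hB.le) hs
    nlinarith

/-- The points of the disk have their logarithm in `D̄(0,p)`, and only two of them have it on the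
circle of radius `p`. -/
lemma sq_add_sq_le_of_cosh_le_slice {p κ σ u v : ℝ} (hp : 0 < p) (hppi : p < Real.pi)
    (h : κ ^ 2 + σ ^ 2 = p ^ 2) (hv : |v| ≤ Real.pi) (hu : Real.cosh u ≤ slice κ σ v) :
    u ^ 2 + (σ + v) ^ 2 ≤ p ^ 2 ∧ (u ^ 2 + (σ + v) ^ 2 = p ^ 2 → v = 0) := by
  -- Complex conjugation changes the signs of `σ` and `v`.
  wlog hv0 : 0 ≤ v generalizing σ v with H
  · have := @H (-σ) (-v) (by rwa [neg_sq]) (by rwa [abs_neg]) (by rwa [slice_neg]) (by linarith)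
    rwa [← neg_add, neg_sq, neg_eq_zero] at this
  rw [abs_of_nonneg hv0] at hv
  have hσ := abs_le_of_sq_le_sq' (show σ ^ 2 ≤ p ^ 2 by nlinarith) hp.le
  have hy : σ + v < Real.pi := by
    by_contra! hy
    linarith [slice_lt_one_of_pos hp hppi h hv0 hv hy, Real.one_le_cosh u]
  rcases hv0.eq_or_lt with rfl | hv1
  · refine ⟨?_, fun _ => rfl⟩
    simp only [slice, CC_sq, Real.cos_zero, Real.sin_zero, mul_one, mul_zero, sub_zero] at hu
    have := sq_le_sq.2 (Real.cosh_le_cosh.1 hu)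
    rw [add_zero]
    linarith
  · have h1 := hu.trans_lt (slice_lt_of_pos hp hppi h hv1 hv hy.le)
    rw [← CC_sq] at h1
    have h2 : (σ + v) ^ 2 < Real.pi ^ 2 := sq_lt_sq' (by linarith) hy
    have h3 := (CC_strictMonoOn.lt_iff_lt (by simp only [Set.mem_Ici]; nlinarith)
      (by simp only [Set.mem_Ici]; nlinarith)).1 h1
    exact ⟨by linarith, fun h4 => by linarith⟩

/-! ### The boundary of the region -/

/-- The logarithm of `gam p t`. -/
noncomputable def logGam (p t : ℝ) : ℂ :=
  ((p * Real.cos t : ℝ) : ℂ) + Complex.I * ((p * Real.sin t : ℝ) : ℂ)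

lemma gam_eq (p t : ℝ) : gam p t = Complex.exp (logGam p t) := rfl

@[simp] lemma logGam_re (p t : ℝ) : (logGam p t).re = p * Real.cos t := by
  simp [logGam, -Complex.ofReal_cos, -Complex.ofReal_sin, -Complex.ofReal_mul]

@[simp] lemma logGam_im (p t : ℝ) : (logGam p t).im = p * Real.sin t := by
  simp [logGam, -Complex.ofReal_cos, -Complex.ofReal_sin, -Complex.ofReal_mul]

lemma norm_eq_iff_sq {p : ℝ} (hp : 0 < p) (w : ℂ) : ‖w‖ = p ↔ w.re ^ 2 + w.im ^ 2 = p ^ 2 := by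
  rw [← sq_eq_sq₀ (norm_nonneg w) hp.le, ← Complex.normSq_eq_norm_sq, Complex.normSq_apply]
  ring_nf

lemma norm_le_iff_sq {p : ℝ} (hp : 0 < p) (w : ℂ) : ‖w‖ ≤ p ↔ w.re ^ 2 + w.im ^ 2 ≤ p ^ 2 := by
  rw [← sq_le_sq₀ (norm_nonneg w) hp.le, ← Complex.normSq_eq_norm_sq, Complex.normSq_apply]
  ring_nf

lemma cos_sq_add_sin_sq_mul (p t : ℝ) :
    (p * Real.cos t) ^ 2 + (p * Real.sin t) ^ 2 = p ^ 2 := by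
  linear_combination p ^ 2 * Real.cos_sq_add_sin_sq t

lemma norm_logGam {p : ℝ} (hp : 0 < p) (t : ℝ) : ‖logGam p t‖ = p := by
  rw [norm_eq_iff_sq hp, logGam_re, logGam_im, cos_sq_add_sin_sq_mul]

lemma abs_im_lt_pi {p : ℝ} (hppi : p < Real.pi) {w : ℂ} (hw : ‖w‖ ≤ p) : |w.im| < Real.pi :=
  (Complex.abs_im_le_norm w).trans_lt (hw.trans_lt hppi)

lemma log_exp_of_norm_le {p : ℝ} (hppi : p < Real.pi) {w : ℂ} (hw : ‖w‖ ≤ p) :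
    Complex.log (Complex.exp w) = w :=
  have h := abs_lt.1 (abs_im_lt_pi hppi hw)
  Complex.log_exp h.1 h.2.le

lemma exp_mem_slitPlane_of_norm_le {p : ℝ} (hppi : p < Real.pi) {w : ℂ} (hw : ‖w‖ ≤ p) :
    Complex.exp w ∈ Complex.slitPlane := by
  rw [Complex.mem_slitPlane_iff_arg]
  have h := abs_im_lt_pi hppi hw
  refine ⟨?_, Complex.exp_ne_zero _⟩
  rw [← Complex.log_im, log_exp_of_norm_le hppi hw]
  exact ((le_abs_self _).trans_lt h).ne

lemma exp_mem_expDisk_iff {p : ℝ} (hppi : p < Real.pi) {w : ℂ} (hw : |w.im| < Real.pi) :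
    Complex.exp w ∈ expDisk p ↔ ‖w‖ ≤ p := by
  refine ⟨?_, fun h => ⟨w, mem_closedBall_zero_iff.2 h, rfl⟩⟩
  rintro ⟨x, hx, hxw⟩
  rw [mem_closedBall_zero_iff] at hx
  have h := congrArg Complex.log hxw
  rw [log_exp_of_norm_le hppi hx, Complex.log_exp (abs_lt.1 hw).1 (abs_lt.1 hw).2.le] at h
  rwa [← h]

lemma gam_pi_sub (p t : ℝ) : gam p (Real.pi - t) =
    Complex.exp (((-(p * Real.cos t) : ℝ) : ℂ) + Complex.I * ((p * Real.sin t : ℝ) : ℂ)) := by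
  rw [gam, Real.cos_pi_sub, Real.sin_pi_sub, mul_neg]

lemma gam_eq_gam_pi_sub_iff_cos {p : ℝ} (hp : 0 < p) (hppi : p < Real.pi) (t : ℝ) :
    gam p t = gam p (Real.pi - t) ↔ Real.cos t = 0 := by
  constructor
  · intro h1
    have h2 := congrArg Complex.log h1
    rw [gam_eq, gam_eq, log_exp_of_norm_le hppi (norm_logGam hp _).le,
      log_exp_of_norm_le hppi (norm_logGam hp _).le] at h2
    have h3 := congrArg Complex.re h2
    rw [logGam_re, logGam_re, Real.cos_pi_sub] at h3
    nlinarith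
  · intro h
    rw [gam_pi_sub, gam, h]
    simp

lemma isClosed_expDisk (p : ℝ) : IsClosed (expDisk p) :=
  ((isCompact_closedBall (0 : ℂ) p).image Complex.continuous_exp).isClosed

/-- Since `p < π`, the exponential is injective on a strip around the disk, so neighborhoods pull
back; they push forward because it is an open map. -/
lemma exp_mem_interior_expDisk_iff {p : ℝ} (hp : 0 < p) (hppi : p < Real.pi) {w : ℂ}
    (hw : ‖w‖ ≤ p) : Complex.exp w ∈ interior (expDisk p) ↔ ‖w‖ < p := by
  constructor
  · intro h
    rw [← mem_ball_zero_iff, ← interior_closedBall (0 : ℂ) hp.ne', mem_interior_iff_mem_nhds]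
    have h1 : Complex.exp ⁻¹' (interior (expDisk p)) ∈ 𝓝 w :=
      Complex.continuous_exp.continuousAt.preimage_mem_nhds (isOpen_interior.mem_nhds h)
    have h2 : ∀ᶠ x : ℂ in 𝓝 w, |x.im| < Real.pi :=
      (Complex.continuous_im.abs.tendsto w).eventually_lt_const (abs_im_lt_pi hppi hw)
    filter_upwards [h1, h2] with x hx1 hx2
    exact mem_closedBall_zero_iff.2 ((exp_mem_expDisk_iff hppi hx2).1 (interior_subset hx1))
  · intro h
    refine interior_mono (Set.image_mono Metric.ball_subset_closedBall) ?_
    rw [(Complex.isOpenMap_exp _ Metric.isOpen_ball).interior_eq]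
    exact ⟨w, mem_ball_zero_iff.2 h, rfl⟩

lemma frontier_expDisk {p : ℝ} (hp : 0 < p) (hppi : p < Real.pi) :
    frontier (expDisk p) = Complex.exp '' Metric.sphere 0 p := by
  rw [(isClosed_expDisk p).frontier_eq]
  ext z
  constructor
  · rintro ⟨⟨w, hw, rfl⟩, h⟩
    rw [mem_closedBall_zero_iff] at hw
    rw [exp_mem_interior_expDisk_iff hp hppi hw, not_lt] at h
    exact ⟨w, mem_sphere_zero_iff_norm.2 (hw.antisymm h), rfl⟩
  · rintro ⟨w, hw, rfl⟩
    rw [mem_sphere_zero_iff_norm] at hw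
    refine ⟨⟨w, mem_closedBall_zero_iff.2 hw.le, rfl⟩, ?_⟩
    rw [exp_mem_interior_expDisk_iff hp hppi hw.le, not_lt]
    exact hw.ge

lemma gam_mem_frontier {p : ℝ} (hp : 0 < p) (hppi : p < Real.pi) (t : ℝ) :
    gam p t ∈ frontier (expDisk p) := by
  rw [frontier_expDisk hp hppi]
  exact ⟨_, mem_sphere_zero_iff_norm.2 (norm_logGam hp t), rfl⟩

/-! ### Disks touching the boundary -/

/-- Along the segment `‖log‖²` starts at its largest possible value `p²`, so its one-sided
derivative, twice this inner product, cannot be positive. -/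
lemma inner_log_nonpos_of_segment {p : ℝ} (hppi : p < Real.pi) {w q : ℂ} (hw : ‖w‖ = p)
    (h : ∀ ε ∈ Set.Ioo (0 : ℝ) 1, Complex.exp w + ε * (q - Complex.exp w) ∈ expDisk p) :
    inner ℝ w ((q - Complex.exp w) / Complex.exp w) ≤ 0 := by
  set z := Complex.exp w
  have h1 : HasDerivAt (fun ε : ℝ => z + ε * (q - z)) (q - z) 0 := by
    simpa using ((hasDerivAt_id (0 : ℝ)).ofReal_comp.mul_const (q - z)).const_add z
  have h2 := (h1.clog_real (by simpa using exp_mem_slitPlane_of_norm_le hppi hw.le)).norm_sq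
  simp only [Complex.ofReal_zero, zero_mul, add_zero] at h2
  rw [log_exp_of_norm_le hppi hw.le] at h2
  have h3 := h2.tendsto_slope_zero_right
  have h4 := le_of_tendsto (b := 0) h3 ?_
  · linarith
  · filter_upwards [Ioo_mem_nhdsGT (zero_lt_one (α := ℝ))] with ε hε
    simp only [zero_add, Complex.ofReal_zero, zero_mul, add_zero]
    rw [log_exp_of_norm_le hppi hw.le, hw]
    obtain ⟨x, hx, hxe⟩ := h ε hε
    rw [mem_closedBall_zero_iff] at hx
    rw [← hxe, log_exp_of_norm_le hppi hx]
    refine smul_nonpos_of_nonneg_of_nonpos (inv_nonneg.2 hε.1.le) ?_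
    have := pow_le_pow_left₀ (norm_nonneg x) hx 2
    linarith

/-- The outer unit normal of `∂ exp D̄(0,p)` at `exp w`. -/
noncomputable def outerNormal (w : ℂ) : ℂ :=
  (‖w * Complex.exp w‖⁻¹ : ℝ) • (w * Complex.exp w)

lemma norm_outerNormal {w : ℂ} (hw : w ≠ 0) : ‖outerNormal w‖ = 1 := by
  have : ‖w * Complex.exp w‖ ≠ 0 := norm_ne_zero_iff.2 (mul_ne_zero hw (Complex.exp_ne_zero _))
  rw [outerNormal, norm_smul, norm_inv, norm_norm, inv_mul_cancel₀ this]

lemma inner_mul_right_eq (w d z : ℂ) (hz : z ≠ 0) :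
    inner ℝ (w * z) d = ‖z‖ ^ 2 * inner ℝ w (d / z) := by
  rw [Complex.inner, Complex.inner, ← Complex.re_ofReal_mul, Complex.ofReal_pow,
    ← Complex.conj_mul', map_mul]
  congr 1
  field_simp

/-- A disk in `exp D̄(0,p)` touching the boundary is internally tangent to it. -/
lemma center_eq_of_touches {p : ℝ} (hp : 0 < p) (hppi : p < Real.pi) {w c : ℂ} {r : ℝ}
    (hw : ‖w‖ = p) (hr : 0 ≤ r) (hD : Metric.closedBall c r ⊆ expDisk p)
    (hz : Complex.exp w ∈ Metric.closedBall c r) : c = Complex.exp w - r • outerNormal w := by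
  have hw0 : w ≠ 0 := norm_pos_iff.1 (hw ▸ hp)
  have he := norm_outerNormal hw0
  set z := Complex.exp w with hzdef
  set e := outerNormal w with hedef
  -- The point of the disk farthest in the direction of the outer normal gives the strongest
  -- condition.
  have hq : c + r • e ∈ Metric.closedBall c r := by
    rw [mem_closedBall_iff_norm, add_sub_cancel_left, norm_smul, he, mul_one, Real.norm_eq_abs,
      abs_of_nonneg hr]
  have h1 : inner ℝ w ((c + r • e - z) / z) ≤ 0 := by
    refine inner_log_nonpos_of_segment hppi hw fun ε hε => hD ?_
    have := (convex_closedBall c r).add_smul_sub_mem hz hq ⟨hε.1.le, hε.2.le⟩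
    rwa [Complex.real_smul] at this
  have h2 : inner ℝ e (c + r • e - z) ≤ 0 := by
    rw [hedef, outerNormal, real_inner_smul_left, inner_mul_right_eq _ _ _ (Complex.exp_ne_zero w)]
    exact mul_nonpos_of_nonneg_of_nonpos (by positivity)
      (mul_nonpos_of_nonneg_of_nonpos (by positivity) h1)
  have h3 : inner ℝ e (c - z) + r ≤ 0 := by
    have : c + r • e - z = (c - z) + r • e := by abel
    rw [this, inner_add_right, real_inner_smul_right, real_inner_self_eq_norm_sq, he] at h2
    linarith
  have h4 : ‖c - z‖ ^ 2 ≤ r ^ 2 := by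
    rw [mem_closedBall_iff_norm, norm_sub_rev] at hz
    exact pow_le_pow_left₀ (norm_nonneg _) hz 2
  -- Equality case of Cauchy-Schwarz: `⟨e, c - z⟩ ≤ -r` while `‖c - z‖ ≤ r`.
  have h5 : ‖(c - z) + r • e‖ ^ 2 ≤ 0 := by
    rw [norm_add_sq_real, real_inner_smul_right, norm_smul, he, mul_one, Real.norm_eq_abs, sq_abs,
      real_inner_comm]
    nlinarith
  have h6 : (c - z) + r • e = 0 := by
    rw [← norm_eq_zero]
    exact pow_eq_zero_iff two_ne_zero |>.1 (le_antisymm h5 (sq_nonneg _))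
  linear_combination h6

/-! ### Balls tangent at a common point with a common normal -/

section Nested

variable {E : Type*} [NormedAddCommGroup E] [InnerProductSpace ℝ E] {z e q : E} {r r' : ℝ}

/-- The bracket is the power of `q` with respect to the sphere. It is affine in `r` with slope `2⟨q
- z, e⟩`, which is why tangent balls are nested. -/
lemma norm_sub_sub_smul_sq (he : ‖e‖ = 1) :
    ‖q - (z - r • e)‖ ^ 2 = r ^ 2 + (‖q - z‖ ^ 2 + 2 * r * inner ℝ (q - z) e) := by
  rw [← sub_add, norm_add_sq_real, real_inner_smul_right, norm_smul, he, mul_one,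
    Real.norm_eq_abs, sq_abs]
  ring

lemma mem_closedBall_sub_smul (he : ‖e‖ = 1) (hr : 0 ≤ r) :
    q ∈ Metric.closedBall (z - r • e) r ↔ ‖q - z‖ ^ 2 + 2 * r * inner ℝ (q - z) e ≤ 0 := by
  rw [mem_closedBall_iff_norm, ← sq_le_sq₀ (norm_nonneg _) hr, norm_sub_sub_smul_sq he,
    add_le_iff_nonpos_right]

lemma mem_ball_sub_smul (he : ‖e‖ = 1) (hr : 0 ≤ r) :
    q ∈ Metric.ball (z - r • e) r ↔ ‖q - z‖ ^ 2 + 2 * r * inner ℝ (q - z) e < 0 := by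
  rw [mem_ball_iff_norm, ← sq_lt_sq₀ (norm_nonneg _) hr, norm_sub_sub_smul_sq he,
    add_lt_iff_neg_left]

lemma closedBall_sub_smul_mono (he : ‖e‖ = 1) (hr : 0 ≤ r) (hrr : r ≤ r') :
    Metric.closedBall (z - r • e) r ⊆ Metric.closedBall (z - r' • e) r' := by
  intro q
  rw [mem_closedBall_sub_smul he hr, mem_closedBall_sub_smul he (hr.trans hrr)]
  intro h
  rcases hr.eq_or_lt with rfl | hr0
  · have : ‖q - z‖ ^ 2 = 0 := le_antisymm (by linarith) (sq_nonneg _)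
    rw [pow_eq_zero_iff two_ne_zero, norm_eq_zero] at this
    simp [this]
  · have : inner ℝ (q - z) e ≤ 0 := by nlinarith [sq_nonneg ‖q - z‖]
    nlinarith

lemma mem_ball_sub_smul_of_lt (he : ‖e‖ = 1) (hr : 0 ≤ r) (hrr : r < r')
    (hq : q ∈ Metric.closedBall (z - r • e) r) (hqz : q ≠ z) :
    q ∈ Metric.ball (z - r' • e) r' := by
  rw [mem_closedBall_sub_smul he hr] at hq
  rw [mem_ball_sub_smul he (hr.trans hrr.le)]
  have h0 : 0 < ‖q - z‖ ^ 2 := by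
    have := norm_pos_iff.2 (sub_ne_zero.2 hqz)
    positivity
  have : inner ℝ (q - z) e < 0 := by
    by_contra! h
    nlinarith [mul_nonneg hr h]
  nlinarith

end Nested

/-! ### The disks in logarithmic coordinates -/

lemma Omega_eq {p : ℝ} (hp : 0 < p) (t : ℝ) :
    Omega p t = Complex.exp (Complex.I * ((p * Real.sin t : ℝ) : ℂ)) *
      ((CC ((p * Real.cos t) ^ 2) : ℝ)
        - Complex.I * ((p * Real.sin t * SS ((p * Real.cos t) ^ 2) : ℝ) : ℂ)) := by
  unfold Omega
  split_ifs with h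
  · have hs : Real.sin t ^ 2 = 1 := by
      have := Real.sin_sq_add_cos_sq t
      rwa [h, zero_pow two_ne_zero, add_zero] at this
    rw [h, mul_zero, CC_sq, zero_pow two_ne_zero, SS_zero, Real.cosh_zero, mul_comm Complex.I,
      Complex.exp_mul_I, ← Complex.ofReal_cos, ← Complex.ofReal_sin]
    rcases sq_eq_one_iff.1 hs with h1 | h1 <;> rw [h1] <;> apply Complex.ext <;>
      simp <;> ring
  · rw [CC_sq, SS_sq (mul_ne_zero hp.ne' h)]
    congr 5
    field_simp

lemma omega_eq {p : ℝ} (hp : 0 < p) (t : ℝ) : omega p t = p * SS ((p * Real.cos t) ^ 2) := by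
  unfold omega
  split_ifs with h
  · simp [h, SS_zero]
  · rw [SS_sq (mul_ne_zero hp.ne' h)]
    field_simp

lemma omega_pos {p : ℝ} (hp : 0 < p) (t : ℝ) : 0 < omega p t := by
  rw [omega_eq hp]
  exact mul_pos hp (SS_pos (by have := sq_nonneg (p * Real.cos t); have := Real.pi_pos; nlinarith))

/-- By orthogonality to the unit circle, the terms free of `v` in the power of the point are `e^{2u}
+ 1 = 2 e^u cosh u`. -/
lemma norm_exp_sub_sq {A B r σ u v : ℝ} (h : A ^ 2 + B ^ 2 = 1 + r ^ 2) :
    ‖Complex.exp (u + Complex.I * (σ + v)) - Complex.exp (Complex.I * σ) * (A - Complex.I * B)‖ ^ 2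
      = r ^ 2 + 2 * Real.exp u * (Real.cosh u - (A * Real.cos v - B * Real.sin v)) := by
  have h1 : Complex.exp (u + Complex.I * (σ + v)) - Complex.exp (Complex.I * σ) *
      (A - Complex.I * B) = Complex.exp (Complex.I * σ) *
        ((Real.exp u : ℝ) * ((Real.cos v : ℝ) + (Real.sin v : ℝ) * Complex.I)
          - (A - Complex.I * B)) := by
    rw [Complex.ofReal_exp, Complex.ofReal_cos, Complex.ofReal_sin, ← Complex.exp_mul_I,
      ← Complex.exp_add, mul_sub (Complex.exp _) (Complex.exp _), ← Complex.exp_add]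
    congr 2
    ring
  have h2 : ‖Complex.exp (Complex.I * σ)‖ = 1 := by
    rw [mul_comm, Complex.norm_exp_ofReal_mul_I]
  rw [h1, norm_mul, h2, one_mul, ← Complex.normSq_eq_norm_sq, Complex.normSq_apply]
  simp only [Complex.sub_re, Complex.mul_re, Complex.ofReal_re, Complex.add_re, Complex.I_re,
    Complex.ofReal_im, Complex.I_im, Complex.sub_im, Complex.mul_im, Complex.add_im, mul_zero,
    zero_mul, mul_one, one_mul, sub_zero, add_zero, zero_add, zero_sub]
  rw [Real.cosh_eq]
  have h3 : Real.exp u * Real.exp (-u) = 1 := by rw [← Real.exp_add]; simp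
  linear_combination h + Real.exp u ^ 2 * Real.cos_sq_add_sin_sq v - h3

lemma norm_Omega_sq {p : ℝ} (t : ℝ) :
    CC ((p * Real.cos t) ^ 2) ^ 2 + (p * Real.sin t * SS ((p * Real.cos t) ^ 2)) ^ 2 =
      1 + (p * SS ((p * Real.cos t) ^ 2)) ^ 2 := by
  have h1 := mul_SS_sq (p * Real.cos t)
  have h2 := Real.cosh_sq (p * Real.cos t)
  rw [CC_sq]
  rw [← h1] at h2
  linear_combination h2 + p ^ 2 * SS ((p * Real.cos t) ^ 2) ^ 2 * Real.sin_sq_add_cos_sq t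

lemma exp_mem_disk_iff {p : ℝ} (hp : 0 < p) (t u v : ℝ) :
    Complex.exp (u + Complex.I * ((p * Real.sin t : ℝ) + v)) ∈ disk p t ↔
      Real.cosh u ≤ slice (p * Real.cos t) (p * Real.sin t) v := by
  rw [disk, mem_closedBall_iff_norm, ← sq_le_sq₀ (norm_nonneg _) (omega_pos hp t).le, Omega_eq hp,
    omega_eq hp, norm_exp_sub_sq (norm_Omega_sq t), add_le_iff_nonpos_right,
    ← neg_nonneg, ← mul_neg, mul_nonneg_iff_of_pos_left (by positivity), neg_nonneg, sub_nonpos,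
    slice]

lemma norm_Omega {p : ℝ} (hp : 0 < p) (t : ℝ) : ‖Omega p t‖ ^ 2 = 1 + omega p t ^ 2 := by
  rw [Omega_eq hp, omega_eq hp, norm_mul, mul_comm Complex.I, Complex.norm_exp_ofReal_mul_I,
    one_mul, ← norm_Omega_sq, ← Complex.normSq_eq_norm_sq, Complex.normSq_apply]
  simp only [Complex.sub_re, Complex.sub_im, Complex.ofReal_re, Complex.ofReal_im, Complex.mul_re,
    Complex.mul_im, Complex.I_re, Complex.I_im]
  ring

lemma exists_log_of_mem_disk {p : ℝ} (hp : 0 < p) (hppi : p < Real.pi) {t : ℝ} {z : ℂ}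
    (hz : z ∈ disk p t) :
    ∃ w, Complex.exp w = z ∧ ‖w‖ ≤ p ∧ (‖w‖ = p → w.im = p * Real.sin t) := by
  have hz0 : z ≠ 0 := by
    rintro rfl
    rw [disk, mem_closedBall_iff_norm, zero_sub, norm_neg,
      ← sq_le_sq₀ (norm_nonneg _) (omega_pos hp t).le, norm_Omega hp] at hz
    linarith
  set σ := p * Real.sin t with hσ
  -- Rotating by `-σ` before taking the principal logarithm puts `v` in `[-π, π]`, the range of the
  -- slice inequality.
  set y := z * Complex.exp (-(Complex.I * σ)) with hy
  have hy0 : y ≠ 0 := mul_ne_zero hz0 (Complex.exp_ne_zero _)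
  set u := (Complex.log y).re
  set v := (Complex.log y).im with hv
  have hzw : Complex.exp (u + Complex.I * (σ + v)) = z := by
    have : (u : ℂ) + Complex.I * (σ + v) = Complex.log y + Complex.I * σ := by
      rw [← Complex.re_add_im (Complex.log y)]
      ring
    rw [this, Complex.exp_add, Complex.exp_log hy0, hy, mul_assoc, ← Complex.exp_add]
    simp
  refine ⟨_, hzw, ?_⟩
  rw [← hzw, exp_mem_disk_iff hp] at hz
  have hvpi : |v| ≤ Real.pi := by
    rw [hv, Complex.log_im]
    exact Complex.abs_arg_le_pi y
  have := sq_add_sq_le_of_cosh_le_slice hp hppi (cos_sq_add_sin_sq_mul p t) hvpi hz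
  rw [norm_le_iff_sq hp, norm_eq_iff_sq hp]
  simp only [Complex.add_re, Complex.ofReal_re, Complex.mul_re, Complex.I_re, Complex.I_im,
    Complex.add_im, Complex.ofReal_im, Complex.mul_im, add_zero, zero_mul, one_mul, sub_zero,
    zero_add, mul_zero]
  exact ⟨this.1, fun h => by rw [this.2 h, add_zero]⟩

lemma disk_subset_expDisk {p : ℝ} (hp : 0 < p) (hppi : p < Real.pi) (t : ℝ) :
    disk p t ⊆ expDisk p := fun _ hz =>
  let ⟨w, h1, h2, _⟩ := exists_log_of_mem_disk hp hppi hz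
  ⟨w, mem_closedBall_zero_iff.2 h2, h1⟩

lemma gam_mem_disk {p : ℝ} (hp : 0 < p) (t : ℝ) : gam p t ∈ disk p t := by
  have := exp_mem_disk_iff hp t (p * Real.cos t) 0
  rw [Complex.ofReal_zero, add_zero] at this
  refine this.2 ?_
  simp [slice, CC_sq]

lemma Omega_omega_eq_of_cos_sin {p s t : ℝ} (hc : Real.cos s = -Real.cos t)
    (hs : Real.sin s = Real.sin t) : Omega p t = Omega p s ∧ omega p t = omega p s := by
  unfold Omega omega
  rw [hc, hs]
  simp [neg_div, div_neg]

lemma disk_pi_sub (p t : ℝ) : disk p (Real.pi - t) = disk p t := by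
  have := Omega_omega_eq_of_cos_sin (p := p) (Real.cos_pi_sub t) (Real.sin_pi_sub t)
  rw [disk, disk, this.1, this.2]

lemma gam_pi_sub_mem_disk {p : ℝ} (hp : 0 < p) (t : ℝ) : gam p (Real.pi - t) ∈ disk p t :=
  disk_pi_sub p t ▸ gam_mem_disk hp _

lemma eq_logGam_of_im_eq {p t : ℝ} (hp : 0 < p) {w : ℂ} (hw : ‖w‖ = p)
    (him : w.im = p * Real.sin t) : w = logGam p t ∨ w = logGam p (Real.pi - t) := by
  rw [norm_eq_iff_sq hp, ← cos_sq_add_sin_sq_mul p t, him, add_left_inj] at hw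
  rcases sq_eq_sq_iff_eq_or_eq_neg.1 hw with h | h
  · left; apply Complex.ext <;> simp [h, him]
  · right; apply Complex.ext <;> simp [h, him, Real.cos_pi_sub, Real.sin_pi_sub]

lemma disk_inter_frontier {p : ℝ} (hp : 0 < p) (hppi : p < Real.pi) (t : ℝ) :
    disk p t ∩ frontier (expDisk p) = {gam p t, gam p (Real.pi - t)} := by
  apply Set.Subset.antisymm
  · rintro z ⟨h1, h2⟩
    obtain ⟨w, rfl, hw, him⟩ := exists_log_of_mem_disk hp hppi h1
    have hwp : ‖w‖ = p := by
      refine hw.antisymm (not_lt.1 fun h => ?_)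
      exact h2.2 ((exp_mem_interior_expDisk_iff hp hppi hw).2 h)
    rcases eq_logGam_of_im_eq hp hwp (him hwp) with h | h
    · left; rw [h, gam_eq]
    · right; rw [h, gam_eq]; rfl
  · rintro z (rfl | rfl)
    · exact ⟨gam_mem_disk hp t, gam_mem_frontier hp hppi t⟩
    · exact ⟨gam_pi_sub_mem_disk hp t, gam_mem_frontier hp hppi _⟩

lemma eq_of_gam_mem_disk {p : ℝ} (hp : 0 < p) (hppi : p < Real.pi) {s t : ℝ}
    (hs : s ∈ Set.Icc (-(Real.pi / 2)) (Real.pi / 2))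
    (ht : t ∈ Set.Icc (-(Real.pi / 2)) (Real.pi / 2)) (h : gam p t ∈ disk p s) : t = s := by
  obtain ⟨w, hw, hwp, him⟩ := exists_log_of_mem_disk hp hppi h
  have h1 := congrArg Complex.log hw
  rw [gam_eq, log_exp_of_norm_le hppi hwp, log_exp_of_norm_le hppi (norm_logGam hp t).le] at h1
  have h2 := him (h1 ▸ norm_logGam hp t)
  rw [h1, logGam_im] at h2
  exact Real.injOn_sin ht hs (mul_left_cancel₀ hp.ne' h2)

/-! ### Maximal disks -/

/-- Both sides are `1` at `h = 0`, with derivatives `p` and `r`. The argument of `CC` is `p² - (p -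
h)²`, the squared abscissa on the circle of radius `p` at height `p - h`. -/
lemma exists_small_CC_lt {p r : ℝ} (hp : 0 < p) (hpr : p < r) :
    ∃ h, 0 < h ∧ h < p ∧ CC (2 * p * h - h ^ 2) < Real.cos h + r * Real.sin h := by
  set f : ℝ → ℝ := fun h => Real.cos h + r * Real.sin h - CC (2 * p * h - h ^ 2) with hf
  have hx : HasDerivAt (fun h : ℝ => 2 * p * h - h ^ 2) (2 * p) 0 := by
    refine (((hasDerivAt_id (0 : ℝ)).const_mul (2 * p)).sub
      ((hasDerivAt_id (0 : ℝ)).pow 2)).congr_deriv ?_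
    simp
  have hd : HasDerivAt f (r - p) 0 := by
    have h1 := HasDerivAt.comp (0 : ℝ) (hasDerivAt_CC (2 * p * 0 - 0 ^ 2)) hx
    refine (((Real.hasDerivAt_cos 0).add ((Real.hasDerivAt_sin 0).const_mul r)).sub
      h1).congr_deriv ?_
    simp [SS_zero]
  have h1 := hd.tendsto_slope_zero_right.eventually_const_lt (sub_pos.2 hpr)
  obtain ⟨h, h2, h3⟩ := (h1.and (Ioo_mem_nhdsGT hp)).exists
  refine ⟨h, h3.1, h3.2, ?_⟩
  have h0 : f 0 = 0 := by simp [hf, CC]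
  rw [zero_add, h0, sub_zero, smul_eq_mul, mul_pos_iff_of_pos_left (inv_pos.2 h3.1)] at h2
  exact sub_pos.1 h2

/-- At `e^{±ip}` the radius of curvature of the boundary is `p`. A larger tangent ball would have
nearby boundary points in its interior. -/
lemma radius_le_of_touches_of_re_eq_zero {p : ℝ} (hp : 0 < p) (hppi : p < Real.pi) {w c : ℂ}
    {r : ℝ} (hw : ‖w‖ = p) (hre : w.re = 0) (hr : 0 ≤ r)
    (hD : Metric.closedBall c r ⊆ expDisk p) (hz : Complex.exp w ∈ Metric.closedBall c r) :
    r ≤ p := by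
  by_contra! hpr
  obtain ⟨h, hh0, hhp, hh⟩ := exists_small_CC_lt hp hpr
  have hc := center_eq_of_touches hp hppi hw hr hD hz
  set σ := w.im with hσ
  have hwσ : w = Complex.I * σ := by apply Complex.ext <;> simp [hre, hσ]
  set s := σ / p with hs
  have hσs : σ = p * s := by rw [hs]; field_simp
  have hσ2 : σ ^ 2 = p ^ 2 := by
    rw [norm_eq_iff_sq hp, hre] at hw
    linarith
  have hs2 : s ^ 2 = 1 := by rw [hs, div_pow, hσ2, div_self (by positivity)]
  have he : outerNormal w = Complex.exp (Complex.I * σ) * (Complex.I * s) := by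
    have h1 : ‖w * Complex.exp w‖ = p := by
      rw [norm_mul, hw, Complex.norm_exp, hre, Real.exp_zero, mul_one]
    have hp' : (p : ℂ) ≠ 0 := by exact_mod_cast hp.ne'
    rw [outerNormal, h1, hwσ, hs, Complex.real_smul]
    push_cast
    field_simp
  have hc' : c = Complex.exp (Complex.I * σ) * ((1 : ℝ) - Complex.I * ((r * s : ℝ) : ℂ)) := by
    rw [hc, he, hwσ, Complex.real_smul]
    push_cast
    ring
  have hx0 : 0 ≤ 2 * p * h - h ^ 2 := by nlinarith
  set u := √(2 * p * h - h ^ 2) with hu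
  have hu2 : u ^ 2 = 2 * p * h - h ^ 2 := Real.sq_sqrt hx0
  -- The logarithm of a nearby boundary point, at height `s(p - h)` with the sign `s = ±1`.
  set q : ℂ := u + Complex.I * (σ + (-(s * h) : ℝ)) with hq
  have hqn : ‖q‖ = p := by
    rw [norm_eq_iff_sq hp]
    have h1 : q.re = u := by simp [hq]
    have h2 : q.im = σ - s * h := by simp [hq]; ring
    rw [h1, h2, hu2, hσs]
    linear_combination (p - h) ^ 2 * hs2
  have hsin : s * Real.sin (s * h) = Real.sin h ∧ Real.cos (s * h) = Real.cos h := by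
    have : (s - 1) * (s + 1) = 0 := by linear_combination hs2
    rcases mul_eq_zero.1 this with h1 | h1
    · have : s = 1 := by linarith
      simp [this]
    · have : s = -1 := by linarith
      simp [this]
  have hqb : Complex.exp q ∈ Metric.ball c r := by
    rw [mem_ball_iff_norm, ← sq_lt_sq₀ (norm_nonneg _) hr, hc', hq,
      norm_exp_sub_sq (r := r) (by linear_combination r ^ 2 * hs2), add_lt_iff_neg_left,
      ← neg_pos, ← mul_neg, mul_pos_iff_of_pos_left (by positivity), neg_pos, sub_neg, ← CC_sq, hu2]
    refine hh.trans_eq ?_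
    rw [Real.cos_neg, Real.sin_neg, hsin.2]
    linear_combination (-r) * hsin.1
  have hqi : Complex.exp q ∈ interior (expDisk p) :=
    interior_maximal (Metric.ball_subset_closedBall.trans hD) Metric.isOpen_ball hqb
  exact ((exp_mem_interior_expDisk_iff hp hppi hqn.le).1 hqi).ne hqn

/-- Both disks have their centers on the same normal, so only the radii matter. A larger radius
would swallow the second contact point, or contradict the curvature bound when there is only one. -/
lemma closedBall_subset_disk_of_touches {p : ℝ} (hp : 0 < p) (hppi : p < Real.pi) {c : ℂ}
    {r τ : ℝ} (hr : 0 ≤ r) (hD : Metric.closedBall c r ⊆ expDisk p)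
    (hz : gam p τ ∈ Metric.closedBall c r) : Metric.closedBall c r ⊆ disk p τ := by
  have hw := norm_logGam hp τ
  have he := norm_outerNormal (norm_pos_iff.1 (hp.trans_eq hw.symm))
  have hc := center_eq_of_touches hp hppi hw hr hD hz
  have hω := omega_pos hp τ
  have hΩ := center_eq_of_touches hp hppi hw hω.le (disk_subset_expDisk hp hppi τ)
    (gam_mem_disk hp τ)
  rw [disk, hΩ, hc]
  rcases le_or_gt r (omega p τ) with h | h
  · exact closedBall_sub_smul_mono he hr h
  exfalso
  by_cases hcos : Real.cos τ = 0
  · have h1 := radius_le_of_touches_of_re_eq_zero hp hppi hw (by simp [hcos]) hr hD hz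
    rw [omega, if_pos hcos] at h
    linarith
  have hne : gam p (Real.pi - τ) ≠ gam p τ := fun h1 =>
    hcos ((gam_eq_gam_pi_sub_iff_cos hp hppi τ).1 h1.symm)
  have h1 := gam_pi_sub_mem_disk hp τ
  rw [disk, hΩ] at h1
  have h2 := mem_ball_sub_smul_of_lt he hω.le h h1 hne
  rw [← hc] at h2
  exact (gam_mem_frontier hp hppi (Real.pi - τ)).2
    (interior_maximal (Metric.ball_subset_closedBall.trans hD) Metric.isOpen_ball h2)

lemma exists_eq_gam_of_mem_frontier {p : ℝ} (hp : 0 < p) (hppi : p < Real.pi) {z : ℂ}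
    (hz : z ∈ frontier (expDisk p)) :
    ∃ t ∈ Set.Icc (-(Real.pi / 2)) (Real.pi / 2), z = gam p t ∨ z = gam p (Real.pi - t) := by
  rw [frontier_expDisk hp hppi] at hz
  obtain ⟨w, hw, rfl⟩ := hz
  rw [mem_sphere_zero_iff_norm] at hw
  have h1 : |w.im / p| ≤ 1 := by
    rw [abs_div, abs_of_pos hp, div_le_one hp, ← hw]
    exact Complex.abs_im_le_norm w
  rw [abs_le] at h1
  refine ⟨Real.arcsin (w.im / p), Real.arcsin_mem_Icc _, ?_⟩
  have h2 : w.im = p * Real.sin (Real.arcsin (w.im / p)) := by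
    rw [Real.sin_arcsin h1.1 h1.2]
    field_simp
  exact (eq_logGam_of_im_eq hp hw h2).imp (fun h => by rw [gam_eq, ← h])
    (fun h => by rw [gam_eq, ← h])

/-- A closed ball in a closed set `K ≠ E` can be enlarged until it touches the boundary. -/
lemma exists_closedBall_touches {E : Type*} [NormedAddCommGroup E] [NormedSpace ℝ E]
    [ProperSpace E] {K : Set E} (hK : IsClosed K) (hne : Kᶜ.Nonempty) {c : E} {r : ℝ} (hr : 0 ≤ r)
    (h : Metric.closedBall c r ⊆ K) :
    ∃ r', r ≤ r' ∧ Metric.closedBall c r' ⊆ K ∧ ∃ z ∈ frontier K, z ∈ Metric.closedBall c r' := by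
  have hsub : Metric.closedBall c (Metric.infDist c Kᶜ) ⊆ K := by
    rcases (Metric.infDist_nonneg (x := c) (s := Kᶜ)).eq_or_lt with h0 | h0
    · rw [← h0, Metric.closedBall_zero]
      exact Set.singleton_subset_iff.2 (h (Metric.mem_closedBall_self hr))
    · rw [← closure_ball c h0.ne']
      exact hK.closure_subset_iff.2 Metric.ball_infDist_compl_subset
  refine ⟨Metric.infDist c Kᶜ, ?_, hsub, ?_⟩
  · refine (Metric.le_infDist hne).2 fun y hy => ?_
    by_contra! hlt
    exact hy (h (Metric.mem_closedBall'.2 hlt.le))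
  · obtain ⟨z, hz, hd⟩ := isClosed_closure.exists_infDist_eq_dist hne.closure c
    rw [Metric.infDist_closure] at hd
    have hzb : z ∈ Metric.closedBall c (Metric.infDist c Kᶜ) := Metric.mem_closedBall'.2 hd.ge
    refine ⟨z, ?_, hzb⟩
    rw [frontier_eq_closure_inter_closure]
    exact ⟨subset_closure (hsub hzb), hz⟩

lemma exists_disk_superset {p : ℝ} (hp : 0 < p) (hppi : p < Real.pi) {D : Set ℂ}
    (hD : IsDiskIn (expDisk p) D) :
    ∃ t ∈ Set.Icc (-(Real.pi / 2)) (Real.pi / 2), D ⊆ disk p t := by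
  obtain ⟨⟨c, r, hr, rfl⟩, hD⟩ := hD
  have hne : (expDisk p)ᶜ.Nonempty := ⟨0, by rintro ⟨w, _, hw⟩; exact Complex.exp_ne_zero w hw⟩
  obtain ⟨r', hrr, hD', z, hz, hzD⟩ := exists_closedBall_touches (isClosed_expDisk p) hne hr hD
  obtain ⟨t, ht, rfl | rfl⟩ := exists_eq_gam_of_mem_frontier hp hppi hz
  · exact ⟨t, ht, (Metric.closedBall_subset_closedBall hrr).trans
      (closedBall_subset_disk_of_touches hp hppi (hr.trans hrr) hD' hzD)⟩
  · refine ⟨t, ht, (Metric.closedBall_subset_closedBall hrr).trans ?_⟩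
    rw [← disk_pi_sub]
    exact closedBall_subset_disk_of_touches hp hppi (hr.trans hrr) hD' hzD

lemma isDiskIn_disk {p : ℝ} (hp : 0 < p) (hppi : p < Real.pi) (t : ℝ) :
    IsDiskIn (expDisk p) (disk p t) :=
  ⟨⟨_, _, (omega_pos hp t).le, rfl⟩, disk_subset_expDisk hp hppi t⟩

lemma setOf_isMaximalDiskIn {p : ℝ} (hp : 0 < p) (hppi : p < Real.pi) :
    {D : Set ℂ | IsMaximalDiskIn (expDisk p) D} =
      disk p '' Set.Icc (-(Real.pi / 2)) (Real.pi / 2) := by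
  ext D
  constructor
  · intro hD
    obtain ⟨t, ht, h⟩ := exists_disk_superset hp hppi hD.prop
    exact ⟨t, ht, (hD.eq_of_subset (isDiskIn_disk hp hppi t) h).symm⟩
  · rintro ⟨t, ht, rfl⟩
    refine ⟨isDiskIn_disk hp hppi t, fun D hD hsub => ?_⟩
    obtain ⟨s, hs, h⟩ := exists_disk_superset hp hppi hD
    -- The contact point of the smaller disk lies in `disk p s`, which forces `t = s`.
    have := eq_of_gam_mem_disk hp hppi hs ht (h (hsub (gam_mem_disk hp t)))
    rwa [this]

/-! ### Parametrizations, tangency, osculation, orthogonality -/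

lemma map_nhds_eq_nhdsWithin_of_inverse {d : ℝ → ℂ} {S : Set ℂ} {z : ℂ} {g : ℂ → ℝ}
    (hd : ContinuousAt d 0) (hd0 : d 0 = z) (hS : ∀ x, d x ∈ S) (hg : ContinuousAt g z)
    (hg0 : g z = 0) (hinv : ∀ w ∈ S, d (g w) = w) : Filter.map d (𝓝 0) = 𝓝[S] z := by
  apply le_antisymm
  · refine tendsto_nhdsWithin_iff.2 ⟨?_, .of_forall hS⟩
    rw [← hd0]
    exact hd
  · intro s hs
    have h1 : g ⁻¹' (d ⁻¹' s) ∈ 𝓝 z := hg.preimage_mem_nhds (by rw [hg0]; exact hs)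
    filter_upwards [mem_nhdsWithin_of_mem_nhds h1, self_mem_nhdsWithin] with w h2 h3
    rw [← hinv w h3]
    exact h2

lemma exp_arg_mul_I_of_norm_eq_one {q : ℂ} (hq : ‖q‖ = 1) : Complex.exp (q.arg * Complex.I) = q := by
  have := Complex.norm_mul_exp_arg_mul_I q
  rwa [hq, Complex.ofReal_one, one_mul] at this

lemma hasDerivAt_mul_exp_mul_I (a : ℂ) (x : ℝ) :
    HasDerivAt (fun x : ℝ => a * Complex.exp (x * Complex.I))
      (a * Complex.exp (x * Complex.I) * Complex.I) x := by
  have h1 := ((hasDerivAt_id x).ofReal_comp.mul_const Complex.I).cexp.const_mul a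
  refine h1.congr_deriv ?_
  simp only [id, Complex.ofReal_one, one_mul]
  ring

lemma contDiff_mul_exp_mul_I (a : ℂ) :
    ContDiff ℝ 2 (fun x : ℝ => a * Complex.exp (x * Complex.I)) :=
  contDiff_const.mul ((Complex.ofRealCLM.contDiff.mul contDiff_const).cexp)

/-- The parametrization of a circle by the angle. -/
lemma isLocalParam_sphere {a z : ℂ} {r : ℝ} (hr : 0 < r) (hz : z ∈ Metric.sphere a r) :
    IsLocalParam (fun x : ℝ => a + (z - a) * Complex.exp (x * Complex.I)) (Metric.sphere a r) z := by
  have hn : ‖z - a‖ = r := mem_sphere_iff_norm.1 hz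
  have h0 : z - a ≠ 0 := norm_pos_iff.1 (hn ▸ hr)
  have hd := fun x => (hasDerivAt_mul_exp_mul_I (z - a) x).const_add a
  refine ⟨by simp, (contDiff_const.add (contDiff_mul_exp_mul_I _)).contDiffAt, ?_, ?_⟩
  · rw [(hd 0).deriv]
    simpa using h0
  · refine map_nhds_eq_nhdsWithin_of_inverse (g := fun w => ((w - a) / (z - a)).arg)
      (hd 0).continuousAt (by simp) (fun x => ?_) ?_ (by simp [div_self h0]) (fun w hw => ?_)
    · rw [mem_sphere_iff_norm, add_sub_cancel_left, norm_mul, hn, Complex.norm_exp_ofReal_mul_I,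
        mul_one]
    · refine ContinuousAt.comp (g := Complex.arg) (Complex.continuousAt_arg ?_) (by fun_prop)
      simp [div_self h0]
    · have h1 : ‖(w - a) / (z - a)‖ = 1 := by
        rw [norm_div, hn, mem_sphere_iff_norm.1 hw, div_self hr.ne']
      rw [exp_arg_mul_I_of_norm_eq_one h1, mul_div_cancel₀ _ h0, add_sub_cancel]

lemma hasDerivAt_exp_mul_exp_mul_I (w : ℂ) (x : ℝ) :
    HasDerivAt (fun x : ℝ => Complex.exp (w * Complex.exp (x * Complex.I)))
      (Complex.exp (w * Complex.exp (x * Complex.I)) *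
        (w * Complex.exp (x * Complex.I) * Complex.I)) x :=
  (hasDerivAt_mul_exp_mul_I w x).cexp

/-- The parametrization of `∂ exp D̄(0,p)` by the angle of the logarithm. -/
lemma isLocalParam_frontier {p : ℝ} (hp : 0 < p) (hppi : p < Real.pi) {w : ℂ} (hw : ‖w‖ = p) :
    IsLocalParam (fun x : ℝ => Complex.exp (w * Complex.exp (x * Complex.I)))
      (frontier (expDisk p)) (Complex.exp w) := by
  have h0 : w ≠ 0 := norm_pos_iff.1 (hw ▸ hp)
  refine ⟨by simp, (contDiff_mul_exp_mul_I w).cexp.contDiffAt, ?_, ?_⟩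
  · rw [(hasDerivAt_exp_mul_exp_mul_I w 0).deriv]
    simpa using h0
  · have hlog : Complex.log (Complex.exp w) = w := log_exp_of_norm_le hppi hw.le
    rw [frontier_expDisk hp hppi]
    refine map_nhds_eq_nhdsWithin_of_inverse (g := fun q => (Complex.log q / w).arg)
      (hasDerivAt_exp_mul_exp_mul_I w 0).continuousAt (by simp) (fun x => ?_) ?_
      (by simp [hlog, div_self h0]) ?_
    · refine ⟨_, ?_, rfl⟩
      rw [mem_sphere_zero_iff_norm, norm_mul, hw, Complex.norm_exp_ofReal_mul_I, mul_one]
    · refine ContinuousAt.comp (g := Complex.arg) (Complex.continuousAt_arg ?_)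
        ((continuousAt_clog (exp_mem_slitPlane_of_norm_le hppi hw.le)).div_const w)
      simp [hlog, div_self h0]
    · rintro _ ⟨q, hq, rfl⟩
      rw [mem_sphere_zero_iff_norm] at hq
      have h1 : ‖q / w‖ = 1 := by rw [norm_div, hq, hw, div_self hp.ne']
      rw [log_exp_of_norm_le hppi hq.le, exp_arg_mul_I_of_norm_eq_one h1, mul_div_cancel₀ _ h0]

lemma gam_sub_Omega {p : ℝ} (hp : 0 < p) (hppi : p < Real.pi) (t : ℝ) :
    gam p t - Omega p t = omega p t • outerNormal (logGam p t) := by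
  have := center_eq_of_touches hp hppi (norm_logGam hp t) (omega_pos hp t).le
    (disk_subset_expDisk hp hppi t) (gam_mem_disk hp t)
  rw [this, gam_eq, sub_sub_cancel]

lemma gam_mem_sphere {p : ℝ} (hp : 0 < p) (hppi : p < Real.pi) (t : ℝ) :
    gam p t ∈ Metric.sphere (Omega p t) (omega p t) := by
  have hn := norm_logGam hp t
  rw [mem_sphere_iff_norm, gam_sub_Omega hp hppi, norm_smul,
    norm_outerNormal (norm_pos_iff.1 (hp.trans_eq hn.symm)), mul_one, Real.norm_eq_abs,
    abs_of_pos (omega_pos hp t)]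

lemma isTangentAt_gam {p : ℝ} (hp : 0 < p) (hppi : p < Real.pi) (t : ℝ) :
    IsTangentAt (Metric.sphere (Omega p t) (omega p t)) (frontier (expDisk p)) (gam p t) := by
  have hn := norm_logGam hp t
  have h0 : logGam p t ≠ 0 := norm_pos_iff.1 (hp.trans_eq hn.symm)
  have h1 : 0 < ‖logGam p t * Complex.exp (logGam p t)‖ :=
    norm_pos_iff.2 (mul_ne_zero h0 (Complex.exp_ne_zero _))
  refine ⟨_, _, isLocalParam_sphere (omega_pos hp t) (gam_mem_sphere hp hppi t),
    isLocalParam_frontier (w := logGam p t) hp hppi hn, omega p t * ‖logGam p t * Complex.exp (logGam p t)‖⁻¹,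
    (mul_pos (omega_pos hp t) (inv_pos.2 h1)).ne', ?_⟩
  rw [((hasDerivAt_mul_exp_mul_I _ 0).const_add _).deriv,
    (hasDerivAt_exp_mul_exp_mul_I _ 0).deriv, gam_sub_Omega hp hppi, outerNormal, smul_smul]
  simp only [Complex.ofReal_zero, zero_mul, Complex.exp_zero, mul_one, Complex.real_smul]
  ring

lemma Omega_pi_sub (p t : ℝ) :
    Omega p t = Omega p (Real.pi - t) ∧ omega p t = omega p (Real.pi - t) :=
  Omega_omega_eq_of_cos_sin (Real.cos_pi_sub t) (Real.sin_pi_sub t)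

lemma isTangentAt_gam_pi_sub {p : ℝ} (hp : 0 < p) (hppi : p < Real.pi) (t : ℝ) :
    IsTangentAt (Metric.sphere (Omega p t) (omega p t)) (frontier (expDisk p))
      (gam p (Real.pi - t)) := by
  rw [(Omega_pi_sub p t).1, (Omega_pi_sub p t).2]
  exact isTangentAt_gam hp hppi _

lemma inversion_gam (p t : ℝ) :
    EuclideanGeometry.inversion (0 : ℂ) 1 (gam p t) = gam p (Real.pi - t) := by
  rw [EuclideanGeometry.inversion, vsub_eq_sub, vadd_eq_add, add_zero, sub_zero, dist_zero_right,
    gam_pi_sub, gam_eq, Complex.norm_exp, logGam_re, one_div, ← Real.exp_neg, sq, ← Real.exp_add,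
    Complex.real_smul, Complex.ofReal_exp, ← Complex.exp_add, logGam]
  congr 1
  push_cast
  ring

lemma cos_eq_zero_iff_of_mem_Icc {t : ℝ} (ht : t ∈ Set.Icc (-(Real.pi / 2)) (Real.pi / 2)) :
    Real.cos t = 0 ↔ t = -(Real.pi / 2) ∨ t = Real.pi / 2 := by
  constructor
  · intro h
    by_contra! hne
    exact (Real.cos_pos_of_mem_Ioo ⟨lt_of_le_of_ne ht.1 hne.1.symm, lt_of_le_of_ne ht.2 hne.2⟩).ne' h
  · rintro (rfl | rfl) <;> simp

/-- Here `z = e^{iσ}` with `σ = ±p`, `c' = -σz` and `c'' = z(σ² - iσ)`, so the curvature is `σ²/p³ =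
1/p`. -/
lemma isOsculatingDisk_of_cos_eq_zero {p : ℝ} (hp : 0 < p) (hppi : p < Real.pi) {t : ℝ}
    (ht : Real.cos t = 0) :
    IsOsculatingDisk (Omega p t) (omega p t) (frontier (expDisk p)) (gam p t) := by
  set σ := p * Real.sin t with hσ
  have hn := norm_logGam hp t
  have hw : logGam p t = Complex.I * σ := by
    rw [logGam, ht, mul_zero, Complex.ofReal_zero, zero_add]
  have hσ2 : σ ^ 2 = p ^ 2 := by
    have := cos_sq_add_sin_sq_mul p t
    rw [ht] at this
    linarith
  set z := Complex.exp (logGam p t) with hz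
  have hzn : ‖z‖ = 1 := by rw [hz, hw, mul_comm, Complex.norm_exp_ofReal_mul_I]
  have hzz : (starRingEnd ℂ) z * z = 1 := by
    rw [Complex.conj_mul', hzn]
    simp
  set c : ℝ → ℂ := fun x => Complex.exp (logGam p t * Complex.exp (x * Complex.I)) with hc
  have hd : deriv c = fun x : ℝ => Complex.exp (logGam p t * Complex.exp (x * Complex.I)) *
      (logGam p t * Complex.exp (x * Complex.I) * Complex.I) :=
    funext fun x => (hasDerivAt_exp_mul_exp_mul_I _ x).deriv
  have hd0 : deriv c 0 = -(z * σ) := by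
    rw [hd]
    simp only [Complex.ofReal_zero, zero_mul, Complex.exp_zero, mul_one]
    rw [← hz, hw]
    linear_combination z * σ * Complex.I_mul_I
  have hdd : deriv (deriv c) 0 = z * (σ ^ 2 - Complex.I * σ) := by
    rw [hd]
    refine ((hasDerivAt_exp_mul_exp_mul_I _ 0).mul
      ((hasDerivAt_mul_exp_mul_I _ 0).mul_const Complex.I)).deriv.trans ?_
    simp only [Complex.ofReal_zero, zero_mul, Complex.exp_zero, mul_one]
    rw [← hz, hw]
    linear_combination (z * σ ^ 2 * (Complex.I ^ 2 - 1) + z * Complex.I * σ) * Complex.I_sq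
  have hdn : ‖deriv c 0‖ = p := by
    rw [hd0, norm_neg, norm_mul, hzn, one_mul, Complex.norm_real, ← sq_eq_sq₀ (norm_nonneg _) hp.le,
      Real.norm_eq_abs, sq_abs, hσ2]
  have hκ : signedCurvature c 0 = p⁻¹ := by
    have h1 : (starRingEnd ℂ) (deriv c 0) * deriv (deriv c) 0 =
        ((-σ ^ 3 : ℝ) : ℂ) + ((σ ^ 2 : ℝ) : ℂ) * Complex.I := by
      rw [hd0, hdd, map_neg, map_mul, Complex.conj_ofReal]
      push_cast
      linear_combination (-σ * (σ ^ 2 - Complex.I * σ)) * hzz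
    rw [signedCurvature, h1, hdn]
    simp only [Complex.add_im, Complex.ofReal_im, Complex.mul_im, Complex.ofReal_re, Complex.I_im,
      Complex.I_re, mul_one, mul_zero, add_zero, zero_add]
    rw [hσ2]
    field_simp
  refine ⟨c, isLocalParam_frontier hp hppi hn, ?_, ?_, ?_⟩
  · rw [hκ]
    exact inv_ne_zero hp.ne'
  · rw [hκ, inv_inv, hdn, hd0, gam_eq, ← hz, Omega_eq hp, ht, mul_zero, CC_sq,
      zero_pow two_ne_zero, SS_zero, Real.cosh_zero, ← hσ, ← hw, ← hz, mul_one, Complex.real_smul]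
    have : (p : ℂ) ≠ 0 := by exact_mod_cast hp.ne'
    push_cast
    field_simp
    ring
  · rw [hκ, abs_inv, inv_inv, abs_of_pos hp, omega, if_pos ht]

lemma circlesOrthogonal_unit {a : ℂ} {r : ℝ} (hr : 0 ≤ r) (h : ‖a‖ ^ 2 = 1 + r ^ 2) :
    CirclesOrthogonal a r 0 1 := by
  constructor
  · have ha : 0 < ‖a‖ := by
      rw [norm_pos_iff]
      rintro rfl
      rw [norm_zero] at h
      nlinarith
    have h1 : ‖(1 : ℂ) + r * Complex.I‖ = ‖a‖ := by
      rw [← sq_eq_sq₀ (norm_nonneg _) ha.le, h, ← Complex.normSq_eq_norm_sq, Complex.normSq_apply]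
      simp
      ring
    have ha' : (‖a‖ : ℂ) ≠ 0 := by exact_mod_cast ha.ne'
    have h2 : ((‖a‖ : ℂ)) ^ 2 = 1 + r ^ 2 := by exact_mod_cast h
    -- The point where a tangent from `a` touches the unit circle: `a/|a|` turned by the angle with
    -- cosine `1/|a|` and sine `r/|a|`.
    refine ⟨(1 + r * Complex.I) * a / (‖a‖ : ℂ) ^ 2, ?_, ?_⟩
    · have h3 : (1 + r * Complex.I) * a / (‖a‖ : ℂ) ^ 2 - a =
          r * Complex.I * (1 + r * Complex.I) * a / (‖a‖ : ℂ) ^ 2 := by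
        field_simp
        rw [h2]
        linear_combination (-a * r ^ 2 : ℂ) * Complex.I_sq
      rw [mem_sphere_iff_norm, h3]
      simp only [norm_div, norm_mul, norm_pow, h1, Complex.norm_real, Complex.norm_I,
        Real.norm_eq_abs, abs_norm, abs_of_nonneg hr]
      field_simp
    · rw [mem_sphere_zero_iff_norm]
      simp only [norm_div, norm_mul, norm_pow, h1, Complex.norm_real, norm_norm]
      field_simp
  · rintro z ⟨h1, h2⟩
    rw [mem_sphere_zero_iff_norm] at h2
    rw [mem_sphere_iff_norm] at h1
    have h3 := norm_sub_sq_real z a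
    rw [h1, h2, h, real_inner_comm] at h3
    rw [sub_zero, inner_sub_left, real_inner_self_eq_norm_sq, h2]
    linarith

/-! ### Time-ordered exponentials -/

/-- The iterated integrals of a matrix-valued function against `φ(θ) dθ`. -/
noncomputable def iterInt (φ B : ℝ → Matrix (Fin 2) (Fin 2) ℝ) :
    ℕ → ℝ → Matrix (Fin 2) (Fin 2) ℝ
  | 0 => B
  | n + 1 => fun x => Matrix.of fun i j => ∫ θ in (0 : ℝ)..x, (φ θ * iterInt φ B n θ) i j

variable {φ A B : ℝ → Matrix (Fin 2) (Fin 2) ℝ}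

lemma lexpTerm_eq_iterInt (n : ℕ) : lexpTerm φ 0 n = iterInt φ (fun _ => 1) n := by
  induction n with
  | zero => rfl
  | succ n ih =>
    funext x
    rw [lexpTerm, iterInt, ih]

lemma continuous_iterInt (hφ : ∀ i j, Continuous fun x => φ x i j)
    (hB : ∀ i j, Continuous fun x => B x i j) (n : ℕ) :
    ∀ i j, Continuous fun x => iterInt φ B n x i j := by
  induction n with
  | zero => exact hB
  | succ n ih =>
    intro i j
    refine intervalIntegral.continuous_primitive (fun a b => Continuous.intervalIntegrable ?_ a b) 0
    simp only [Matrix.mul_apply]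
    exact continuous_finsetSum _ fun k _ => (hφ i k).mul (ih k j)

lemma continuous_mul_iterInt (hφ : ∀ i j, Continuous fun x => φ x i j)
    (hB : ∀ i j, Continuous fun x => B x i j) (n : ℕ) (i j : Fin 2) :
    Continuous fun x => (φ x * iterInt φ B n x) i j := by
  simp only [Matrix.mul_apply]
  exact continuous_finsetSum _ fun k _ => (hφ i k).mul (continuous_iterInt hφ hB n k j)

/-- The factor `2` counts the summands in an entry of a product of `2 × 2` matrices. -/
lemma abs_iterInt_le (hφ1 : ∀ x i j, |φ x i j| ≤ 1) {K b : ℝ}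
    (hK : ∀ x ∈ Set.Icc 0 b, ∀ i j, |B x i j| ≤ K) (n : ℕ) :
    ∀ x ∈ Set.Icc 0 b, ∀ i j, |iterInt φ B n x i j| ≤ K * ((2 * x) ^ n / n.factorial) := by
  induction n with
  | zero =>
    intro x hx i j
    simpa [iterInt] using hK x hx i j
  | succ n ih =>
    intro x hx i j
    have h1 : ∀ y ∈ Set.Ioc 0 x, ‖(φ y * iterInt φ B n y) i j‖ ≤
        2 * K * 2 ^ n / n.factorial * y ^ n := fun y hy => by
      have hy' : y ∈ Set.Icc 0 b := ⟨hy.1.le, hy.2.trans hx.2⟩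
      have h2 : ∀ k, ‖φ y i k * iterInt φ B n y k j‖ ≤ K * ((2 * y) ^ n / n.factorial) :=
        fun k => by
          rw [norm_mul, ← one_mul (K * _)]
          exact mul_le_mul (hφ1 y i k) (ih y hy' k j) (norm_nonneg _) zero_le_one
      rw [Matrix.mul_apply, Fin.sum_univ_two]
      refine (norm_add_le _ _).trans ((add_le_add (h2 0) (h2 1)).trans_eq ?_)
      rw [mul_pow]
      ring
    have h3 := intervalIntegral.norm_integral_le_of_norm_le
      (μ := MeasureTheory.volume) hx.1 (.of_forall h1)
      (Continuous.intervalIntegrable (by fun_prop) _ _)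
    rw [intervalIntegral.integral_const_mul, integral_pow] at h3
    refine h3.trans_eq ?_
    rw [zero_pow (Nat.succ_ne_zero n), sub_zero, Nat.factorial_succ, mul_pow]
    push_cast
    field_simp
    ring

/-- The integral equation `A = 1 + ∫ φ A`, integrated `n` more times against `φ`. -/
lemma iterInt_eq_add (hφ : ∀ i j, Continuous fun x => φ x i j)
    (hA : ∀ x i j, HasDerivAt (fun x => A x i j) ((φ x * A x) i j) x) (hA0 : A 0 = 1) (n : ℕ) :
    ∀ x, iterInt φ A n x = lexpTerm φ 0 n x + iterInt φ A (n + 1) x := by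
  have hAc : ∀ i j, Continuous fun x => A x i j := fun i j =>
    continuous_iff_continuousAt.2 fun x => (hA x i j).continuousAt
  induction n with
  | zero =>
    intro x
    ext i j
    have h := intervalIntegral.integral_eq_sub_of_hasDerivAt (fun y _ => hA y i j)
      ((continuous_mul_iterInt hφ hAc 0 i j).intervalIntegrable 0 x)
    rw [hA0] at h
    simp only [iterInt, lexpTerm, Matrix.add_apply, Matrix.of_apply]
    linarith
  | succ n ih =>
    intro x
    ext i j
    rw [Matrix.add_apply, iterInt, iterInt, lexpTerm_eq_iterInt, iterInt]
    simp only [Matrix.of_apply]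
    refine Eq.trans ?_ (intervalIntegral.integral_add
      ((continuous_mul_iterInt (B := fun _ => 1) hφ (fun _ _ => continuous_const) n i
        j).intervalIntegrable 0 x)
      ((continuous_mul_iterInt hφ hAc (n + 1) i j).intervalIntegrable 0 x))
    refine intervalIntegral.integral_congr fun y _ => ?_
    rw [ih y, lexpTerm_eq_iterInt, mul_add, Matrix.add_apply]

lemma sum_lexpTerm (hφ : ∀ i j, Continuous fun x => φ x i j)
    (hA : ∀ x i j, HasDerivAt (fun x => A x i j) ((φ x * A x) i j) x) (hA0 : A 0 = 1) (n : ℕ)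
    (x : ℝ) : ∑ k ∈ Finset.range n, lexpTerm φ 0 k x = A x - iterInt φ A n x := by
  induction n with
  | zero => simp [iterInt]
  | succ n ih =>
    rw [Finset.sum_range_succ, ih, iterInt_eq_add hφ hA hA0]
    abel

/-- The time-ordered exponential is the solution of the linear differential equation `A' = φ A`. -/
lemma hasSum_lexpTerm (hφ : ∀ i j, Continuous fun x => φ x i j) (hφ1 : ∀ x i j, |φ x i j| ≤ 1)
    (hA : ∀ x i j, HasDerivAt (fun x => A x i j) ((φ x * A x) i j) x) (hA0 : A 0 = 1) {b : ℝ}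
    (hb : 0 ≤ b) : HasSum (fun n => lexpTerm φ 0 n b) (A b) := by
  have hAc : ∀ i j, Continuous fun x => A x i j := fun i j =>
    continuous_iff_continuousAt.2 fun x => (hA x i j).continuousAt
  have hbb : b ∈ Set.Icc 0 b := Set.right_mem_Icc.2 hb
  refine Pi.hasSum.2 fun i => Pi.hasSum.2 fun j => ?_
  have hs : Summable fun n => lexpTerm φ 0 n b i j := by
    refine Summable.of_norm_bounded (Real.summable_pow_div_factorial (2 * b)) fun n => ?_
    have := abs_iterInt_le hφ1 (B := fun _ => 1) (K := 1) (b := b) (fun x _ i j => ?_) n b hbb i j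
    · rwa [one_mul, ← lexpTerm_eq_iterInt] at this
    · rw [Matrix.one_apply]
      split_ifs <;> simp
  rw [hs.hasSum_iff_tendsto_nat]
  obtain ⟨K, hK⟩ := isCompact_Icc.exists_bound_of_continuousOn (s := Set.Icc 0 b)
    (f := fun x => ∑ k, ∑ l, |A x k l|)
    (continuous_finsetSum _ fun k _ => continuous_finsetSum _ fun l _ =>
      (hAc k l).abs).continuousOn
  have hK' : ∀ x ∈ Set.Icc 0 b, ∀ k l, |A x k l| ≤ K := fun x hx k l => by
    refine le_trans ?_ ((le_abs_self _).trans (hK x hx))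
    exact (Finset.single_le_sum (f := fun l => |A x k l|) (fun _ _ => abs_nonneg _)
      (Finset.mem_univ l)).trans (Finset.single_le_sum (f := fun k => ∑ l, |A x k l|)
        (fun _ _ => Finset.sum_nonneg fun _ _ => abs_nonneg _) (Finset.mem_univ k))
  have h1 : Filter.Tendsto (fun n => iterInt φ A n b i j) Filter.atTop (𝓝 0) := by
    refine squeeze_zero_norm (fun n => abs_iterInt_le hφ1 hK' n b hbb i j) ?_
    have := (FloorSemiring.tendsto_pow_div_factorial_atTop (2 * b)).const_mul K
    rwa [mul_zero] at this
  have h2 := h1.const_sub (A b i j)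
  rw [sub_zero] at h2
  refine h2.congr fun n => ?_
  have := congrFun (congrFun (sum_lexpTerm hφ hA hA0 n b) i) j
  rw [Matrix.sum_apply, Matrix.sub_apply] at this
  exact this.symm

/-! ### The hyperbolic development -/

lemma abs_Phi_le (s x : ℝ) (i j : Fin 2) : |Phi s x i j| ≤ 1 := by
  fin_cases i <;> fin_cases j <;>
    simp [Phi, Real.abs_sin_le_one, Real.abs_cos_le_one]

lemma continuous_Phi (s : ℝ) (i j : Fin 2) : Continuous fun x => Phi s x i j := by
  fin_cases i <;> fin_cases j <;> simp [Phi] <;> fun_prop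

lemma W_zero : W 0 0 = 1 := by
  have h1 : CC 0 = 1 := by simp [CC]
  ext i j
  fin_cases i <;> fin_cases j <;> simp [W, h1]

/-- With `R` the rotation and `J` the swap of coordinates, `Φ_s(x) = R(2xs) J`, hence `Φ_s(x) R(xs)
= R(xs) J`; this is `e1` and `e2`. In the rotating frame the equation has the constant coefficient
matrix with rows `(0, 1+s)` and `(1-s, 0)`, whose square is `1 - s²`, and the second factor of `W`
is its exponential. -/
lemma hasDerivAt_W (s x : ℝ) (i j : Fin 2) :
    HasDerivAt (fun x => W x (x * s) i j) ((Phi s x * W x (x * s)) i j) x := by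
  have hx : HasDerivAt (fun x : ℝ => x ^ 2 - (x * s) ^ 2) (2 * x * (1 - s ^ 2)) x := by
    refine (((hasDerivAt_id x).pow 2).sub
      (((hasDerivAt_id x).mul_const s).pow 2)).congr_deriv ?_
    simp only [id]
    norm_num
    ring
  have hC := (hasDerivAt_CC _).comp x hx
  have hS := (hasDerivAt_SS _).comp x hx
  have hT : HasDerivAt (fun x => x * SS (x ^ 2 - (x * s) ^ 2)) (CC (x ^ 2 - (x * s) ^ 2)) x := by
    refine ((hasDerivAt_id x).mul hS).congr_deriv ?_
    simp only [Function.comp_apply, id]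
    linear_combination -CC_sub_SS (x ^ 2 - (x * s) ^ 2)
  have hc := ((hasDerivAt_id x).mul_const s).cos
  have hn := ((hasDerivAt_id x).mul_const s).sin
  have e1 : Real.sin (2 * (x * s)) * Real.cos (x * s) - Real.cos (2 * (x * s)) * Real.sin (x * s)
      = Real.sin (x * s) := by
    rw [← Real.sin_sub]; ring_nf
  have e2 : Real.cos (2 * (x * s)) * Real.cos (x * s) + Real.sin (2 * (x * s)) * Real.sin (x * s)
      = Real.cos (x * s) := by
    rw [← Real.cos_sub]; ring_nf
  simp only [id] at hc hn
  set C := CC (x ^ 2 - (x * s) ^ 2)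
  set S := SS (x ^ 2 - (x * s) ^ 2)
  fin_cases i <;> fin_cases j
  · refine (((hc.mul hC).sub ((hn.mul hT).mul_const (1 - s))).congr_of_eventuallyEq
      (.of_forall fun y => ?_)).congr_deriv ?_
    · simp [W, Matrix.mul_apply, Fin.sum_univ_two]
      ring
    · simp [W, Phi, Matrix.mul_apply, Fin.sum_univ_two, -mul_eq_mul_left_iff]
      linear_combination C * e1 - x * (1 - s) * S * e2
  · refine (((hc.mul hT).mul_const (1 + s)).sub (hn.mul hC) |>.congr_of_eventuallyEq
      (.of_forall fun y => ?_)).congr_deriv ?_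
    · simp [W, Matrix.mul_apply, Fin.sum_univ_two]
      ring
    · simp [W, Phi, Matrix.mul_apply, Fin.sum_univ_two, -mul_eq_mul_left_iff]
      linear_combination x * (1 + s) * S * e1 - C * e2
  · refine (((hn.mul hC).add ((hc.mul hT).mul_const (1 - s))).congr_of_eventuallyEq
      (.of_forall fun y => ?_)).congr_deriv ?_
    · simp [W, Matrix.mul_apply, Fin.sum_univ_two]
      ring
    · simp [W, Phi, Matrix.mul_apply, Fin.sum_univ_two, -mul_eq_mul_left_iff]
      linear_combination -x * (1 - s) * S * e1 - C * e2
  · refine (((hn.mul hT).mul_const (1 + s)).add (hc.mul hC) |>.congr_of_eventuallyEq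
      (.of_forall fun y => ?_)).congr_deriv ?_
    · simp [W, Matrix.mul_apply, Fin.sum_univ_two]
      ring
    · simp [W, Phi, Matrix.mul_apply, Fin.sum_univ_two, -mul_eq_mul_left_iff]
      linear_combination -C * e1 - x * (1 + s) * S * e2

lemma hasSum_lexpTerm_Phi {p : ℝ} (hp : 0 ≤ p) (s : ℝ) :
    HasSum (fun n => lexpTerm (Phi s) 0 n p) (W p (p * s)) :=
  hasSum_lexpTerm (A := fun x => W x (x * s)) (continuous_Phi s) (abs_Phi_le s) (hasDerivAt_W s)
    (by simp [W_zero]) hp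

/-- The second factor of `W` has chiral center `C - iσS` and radius `pS`; the rotation on the left
multiplies the center by `e^{iσ}` and keeps the radius. -/
lemma chiralDisk_W {p : ℝ} (hp : 0 < p) (t : ℝ) :
    chiralDisk (W p (p * Real.sin t)) = disk p t := by
  have h : p ^ 2 - (p * Real.sin t) ^ 2 = (p * Real.cos t) ^ 2 := by
    linear_combination -cos_sq_add_sin_sq_mul p t
  have h0 := omega_pos hp t
  rw [disk, chiralDisk]
  congr 1
  · rw [Omega_eq hp, mul_comm Complex.I, Complex.exp_mul_I, ← Complex.ofReal_cos,
      ← Complex.ofReal_sin]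
    simp only [W, h]
    apply Complex.ext <;>
      simp [Matrix.mul_apply, Fin.sum_univ_two, -Complex.ofReal_cos, -Complex.ofReal_sin,
        -Complex.ofReal_mul] <;> ring
  · rw [← Real.sqrt_sq h0.le, omega_eq hp]
    congr 1
    simp only [W, h]
    simp [Matrix.mul_apply, Fin.sum_univ_two]
    linear_combination (p * SS ((p * Real.cos t) ^ 2)) ^ 2 *
      Real.cos_sq_add_sin_sq (p * Real.sin t)

end MagnusDisks

theorem mainTheorem8 (p : ℝ) (hp0 : 0 < p) (hppi : p < Real.pi) :
    -- (a) tangency, inversion, osculation, orthogonality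
    (∀ t ∈ Set.Icc (-(Real.pi / 2)) (Real.pi / 2),
      0 < omega p t ∧
      gam p (Real.pi - t) =
        Complex.exp (((-(p * Real.cos t) : ℝ) : ℂ) + Complex.I * ((p * Real.sin t : ℝ) : ℂ)) ∧
      IsTangentAt (Metric.sphere (Omega p t) (omega p t)) (frontier (expDisk p)) (gam p t) ∧
      IsTangentAt (Metric.sphere (Omega p t) (omega p t)) (frontier (expDisk p))
        (gam p (Real.pi - t)) ∧
      EuclideanGeometry.inversion (0 : ℂ) 1 (gam p t) = gam p (Real.pi - t) ∧
      (gam p t = gam p (Real.pi - t) ↔ t = -(Real.pi / 2) ∨ t = Real.pi / 2) ∧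
      (gam p t = gam p (Real.pi - t) →
        IsOsculatingDisk (Omega p t) (omega p t) (frontier (expDisk p)) (gam p t)) ∧
      CirclesOrthogonal (Omega p t) (omega p t) 0 1) ∧
    -- (a) the disks are distinct, and the symmetry of the extended family
    Set.InjOn (disk p) (Set.Icc (-(Real.pi / 2)) (Real.pi / 2)) ∧
    (∀ t ∈ Set.Icc (-Real.pi) Real.pi, ∀ s ∈ Set.Icc (-Real.pi) Real.pi,
      (s : Real.Angle) = ((Real.pi - t : ℝ) : Real.Angle) →
        Omega p t = Omega p s ∧ omega p t = omega p s) ∧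
    -- (b) the disks are the chiral disks of the hyperbolic developments
    (∀ t ∈ Set.Icc (-(Real.pi / 2)) (Real.pi / 2),
      Summable (fun n : ℕ => lexpTerm (Phi (Real.sin t)) 0 n p) ∧
      chiralDisk (lexp (Phi (Real.sin t)) 0 p) = chiralDisk (W p (p * Real.sin t)) ∧
      chiralDisk (W p (p * Real.sin t)) = disk p t) ∧
    -- (c) the disks are exactly the maximal disks, and where they touch the boundary
    {D : Set ℂ | IsMaximalDiskIn (expDisk p) D} =
      disk p '' Set.Icc (-(Real.pi / 2)) (Real.pi / 2) ∧
    (∀ t ∈ Set.Icc (-(Real.pi / 2)) (Real.pi / 2),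
      disk p t ∩ frontier (expDisk p) = {gam p t, gam p (Real.pi - t)}) := by
  refine ⟨fun t ht => ⟨omega_pos hp0 t, gam_pi_sub p t, isTangentAt_gam hp0 hppi t,
    isTangentAt_gam_pi_sub hp0 hppi t, inversion_gam p t, ?_, fun h => ?_,
    circlesOrthogonal_unit (omega_pos hp0 t).le (norm_Omega hp0 t)⟩, fun t ht s hs h => ?_,
    fun t _ s _ h => ?_, fun t _ => ?_, setOf_isMaximalDiskIn hp0 hppi,
    fun t _ => disk_inter_frontier hp0 hppi t⟩
  · rw [gam_eq_gam_pi_sub_iff_cos hp0 hppi, cos_eq_zero_iff_of_mem_Icc ht]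
  · exact isOsculatingDisk_of_cos_eq_zero hp0 hppi ((gam_eq_gam_pi_sub_iff_cos hp0 hppi t).1 h)
  · exact eq_of_gam_mem_disk hp0 hppi hs ht (h ▸ gam_mem_disk hp0 t)
  · have hc := congrArg Real.Angle.cos h
    have hs := congrArg Real.Angle.sin h
    rw [Real.Angle.cos_coe, Real.Angle.cos_coe, Real.cos_pi_sub] at hc
    rw [Real.Angle.sin_coe, Real.Angle.sin_coe, Real.sin_pi_sub] at hs
    exact Omega_omega_eq_of_cos_sin hc hs
  · have h := hasSum_lexpTerm_Phi hp0.le (Real.sin t)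
    exact ⟨h.summable, by rw [lexp, h.tsum_eq], chiralDisk_W hp0 t⟩
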